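/- Let $k,m\ge 1$ and $n=k+m$. Indices $\alpha,\beta,\dots$ run over $1,\dots,k$, indices $\alpha',\beta',\dots$ over $k+1,\dots,n$, and $i,j,\dots$ over $1,\dots,n$. Fix a reference nondegenerate symmetric bilinear form $h$ on $\mathbb R^n=\mathbb R^k\oplus\mathbb R^m$ (of any signature) with $\mathbb R^k\perp\mathbb R^m$. Let $(M^n,g)$ be a smooth pseudo-Riemannian manifold and $\Sigma^k\subset M$ an embedded submanifold, with inclusion $\iota$, such that $\iota^*g$ is nondegenerate. Let $\nabla$ be the Levi-Civita connection of $g$, let $\overline\nabla$ denote the induced connections on $T\Sigma$ and on the normal bundle $N\Sigma$, let $\mathrm{Rm}\in\Gamma((T^*M)^{\otimes 4})$ be the curvature tensor of $g$, and let $L(X,Y)=(\nabla_XY)^\perp$, $L\in\Gamma(S^2T^*\Sigma\otimes N\Sigma)$, be the second fundamental form of $\Sigma$. Let $p\in\Sigma$, and let $\{e_\alpha\}$, $\{e_{\alpha'}\}$ be frames for $T_p\Sigma$ and $N_p\Sigma$ with $g(e_\alpha,e_\beta)=h_{\alpha\beta}$ and $g(e_{\alpha'},e_{\beta'})=h_{\alpha'\beta'}$.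 The submanifold geodesic normal coordinates $z=(x,u)$ near $p$ determined by these frames are the coordinates of $M$, with $p=\{z=0\}$ and $\Sigma=\{u=0\}$, constructed as follows near $p$. On $\Sigma$, $x$ are the geodesic normal coordinates of $\iota^*g$: $\exp^{\iota^*g}_p(x^\alpha e_\alpha)$ is the point with coordinates $(x,0)$. Extend each $e_{\alpha'}$ to a section of $N\Sigma$ near $p$ that is parallel with respect to $\overline\nabla$ along each radial geodesic $t\mapsto\exp^{\iota^*g}_p(t\,x^\alpha e_\alpha)$. Then $$\exp^g_{\exp^{\iota^*g}_p(x^\alpha e_\alpha)}(u^{\alpha'}e_{\alpha'})$$ is the point with coordinates $(x,u)$. In these coordinates write $g=g_{ij}\,dz^i\,dz^j$. **Theorem.** For all $i,j$ and every list $K$ of indices in $\{1,\dots,n\}$ there is a polynomial $P$ with real coefficients, in finitely many of the variables that stand for the components of $\nabla^r\mathrm{Rm}$ and of $\overline\nabla{}^rL$ $(r\ge0)$, which depends only on $k$, $m$, $h$, $i$, $j$, $K$ (and not on $M$, $g$, $\Sigma$, $p$ or the frames), such that in every such situation $\partial_z^Kg_{ij}(p)$ is the value of $P$ at the components at $p$,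 in the coordinates $z$, of the iterated covariant derivatives $\nabla^r\mathrm{Rm}$ of the curvature tensor of $g$ and of the iterated covariant derivatives $\overline\nabla{}^rL$ of the second fundamental form of $\Sigma$. -/

import Mathlib

open scoped Manifold ContDiff Topology

noncomputable section

namespace SubmanifoldNormal

/-! ### Tensor calculus on open subsets of coordinate space

A metric is given here by its matrix of components `G : (ι → ℝ) → Matrix ι ι ℝ`. -/

section Coordinates

variable {ι : Type} [Fintype ι] [DecidableEq ι]

/-- The partial derivative `∂f/∂z^i`. -/
def partialDeriv (i : ι) (f : (ι → ℝ) → ℝ) : (ι → ℝ) → ℝ :=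
  fun z => fderiv ℝ f z (Pi.single i 1)

/-- The iterated partial derivative `∂_z^K f` for a list `K` of indices. -/
def iterPartial (K : List ι) (f : (ι → ℝ) → ℝ) : (ι → ℝ) → ℝ :=
  K.foldr partialDeriv f

/-- The Christoffel symbol `Γ^l_{ij}` of the Levi-Civita connection:
`Γ^l_{ij} = ½ g^{ls} (∂_i g_{js} + ∂_j g_{is} - ∂_s g_{ij})`. -/
def christoffel (G : (ι → ℝ) → Matrix ι ι ℝ) (z : ι → ℝ) (l i j : ι) : ℝ :=
  (1 / 2 : ℝ) * ∑ s, (G z)⁻¹ l s *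
    (partialDeriv i (fun y => G y j s) z + partialDeriv j (fun y => G y i s) z
      - partialDeriv s (fun y => G y i j) z)

/-- The curvature `R^i_{jkl}`, where
`R(∂_k, ∂_l) ∂_j = ∇_k ∇_l ∂_j - ∇_l ∇_k ∂_j = R^i_{jkl} ∂_i`. -/
def curvature (G : (ι → ℝ) → Matrix ι ι ℝ) (z : ι → ℝ) (i j k l : ι) : ℝ :=
  partialDeriv k (fun y => christoffel G y i l j) z
    - partialDeriv l (fun y => christoffel G y i k j) z
    + ∑ s, (christoffel G z i k s * christoffel G z s l j
      - christoffel G z i l s * christoffel G z s k j)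

/-- The covariant curvature tensor `R_{ijkl} = g_{is} R^s_{jkl}`, at the index list
`I = (i, j, k, l)`. -/
def riemann (G : (ι → ℝ) → Matrix ι ι ℝ) (z : ι → ℝ) (I : Fin 4 → ι) : ℝ :=
  ∑ s, G z (I 0) s * curvature G z s (I 1) (I 2) (I 3)

/-- The covariant derivative of a covariant tensor field of rank `r`; the index of
differentiation is put last:
`(∇T)_{i₁ … i_r m} = ∂_m T_{i₁ … i_r} - ∑_s Γ^l_{m i_s} T_{i₁ … l … i_r}`. -/
def covDeriv (G : (ι → ℝ) → Matrix ι ι ℝ) {r : ℕ} (T : (ι → ℝ) → (Fin r → ι) → ℝ)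
    (z : ι → ℝ) (I : Fin (r + 1) → ι) : ℝ :=
  partialDeriv (I (Fin.last r)) (fun y => T y (Fin.init I)) z
    - ∑ s : Fin r, ∑ l, christoffel G z l (I (Fin.last r)) (Fin.init I s) *
        T z (Function.update (Fin.init I) s l)

/-- The iterated covariant derivative `∇^r Rm`. -/
def iterCovRiemann (G : (ι → ℝ) → Matrix ι ι ℝ) :
    (r : ℕ) → (ι → ℝ) → (Fin (4 + r) → ι) → ℝ
  | 0 => riemann G
  | r + 1 => covDeriv G (iterCovRiemann G r)

/-- The covariant derivative along a curve `c` of a vector field `W` along `c`: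
`(D_t W)^i = dW^i/dt + Γ^i_{jl} (dc^j/dt) W^l`. -/
def covDerivAlong (G : (ι → ℝ) → Matrix ι ι ℝ) (c W : ℝ → ι → ℝ) (t : ℝ) : ι → ℝ :=
  fun i => deriv (fun s => W s i) t
    + ∑ j, ∑ l, christoffel G (c t) i j l * deriv (fun s => c s j) t * W t l

end Coordinates

/-! ### The geometry of the coordinate slice `{u = 0}`

Coordinates are `z = (x, u)` with `x ∈ ℝ^k` and `u ∈ ℝ^m`.  The indices `α` of `x` are the
`Sum.inl α` and the indices `α'` of `u` are the `Sum.inr α'`. -/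

/-- The coordinate space `ℝ^k ⊕ ℝ^m`. -/
abbrev Model (k m : ℕ) : Type := Fin k ⊕ Fin m → ℝ

section Slice

variable {k m : ℕ}

/-- The point `(x, 0)`. -/
def onSlice (x : Fin k → ℝ) : Model k m := Sum.elim x 0

/-- The part `x` of `z = (x, u)`. -/
def tangentialPart (z : Model k m) : Fin k → ℝ := fun a => z (Sum.inl a)

/-- The components `g_{αβ}(x, 0)` of the pullback metric on the slice. -/
def inducedMetric (G : Model k m → Matrix (Fin k ⊕ Fin m) (Fin k ⊕ Fin m) ℝ)
    (x : Fin k → ℝ) : Matrix (Fin k) (Fin k) ℝ :=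
  fun a b => G (onSlice x) (Sum.inl a) (Sum.inl b)

/-- The orthogonal projection `W ↦ W^⊥ = W - ḡ^{αβ} g(∂_β, W) ∂_α` at `(x, 0)` of an ambient
vector to the normal space of the slice. -/
def normalProj (G : Model k m → Matrix (Fin k ⊕ Fin m) (Fin k ⊕ Fin m) ℝ)
    (x : Fin k → ℝ) (W : Model k m) : Model k m :=
  Sum.elim
    (fun a => W (Sum.inl a)
      - ∑ b, (inducedMetric G x)⁻¹ a b * ∑ j, G (onSlice x) (Sum.inl b) j * W j)
    (fun c => W (Sum.inr c))

/-- The frame `n_{α'} = (∂_{α'})^⊥` of the normal bundle of the slice.  A normal vector `W` is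
`∑_{α'} W^{α'} n_{α'}`, where `W^{α'}` are the `u`-components of `W`.  If the `∂_{α'}` are normal
to the slice then `n_{α'} = ∂_{α'}`. -/
def normalFrame (G : Model k m → Matrix (Fin k ⊕ Fin m) (Fin k ⊕ Fin m) ℝ)
    (b : Fin m) (x : Fin k → ℝ) : Model k m :=
  normalProj G x (Pi.single (Sum.inr b) 1)

/-- The second fundamental form: the component `L_{αβ}^{γ'}` of
`L(∂_α, ∂_β) = (∇_{∂_α} ∂_β)^⊥`, where `∇_{∂_α} ∂_β = Γ^i_{αβ} ∂_i`, in the frame `n_{γ'}`. -/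
def secondFF (G : Model k m → Matrix (Fin k ⊕ Fin m) (Fin k ⊕ Fin m) ℝ)
    (x : Fin k → ℝ) (I : Fin 2 → Fin k) (c : Fin m) : ℝ :=
  normalProj G x
    (fun i => christoffel G (onSlice x) i (Sum.inl (I 0)) (Sum.inl (I 1))) (Sum.inr c)

/-- The coefficient `B_{αβ'}^{γ'}` of the induced connection of the normal bundle:
`∇̄_{∂_α} n_{β'} = (∇_{∂_α} n_{β'})^⊥ = B_{αβ'}^{γ'} n_{γ'}`. -/
def normalConnection (G : Model k m → Matrix (Fin k ⊕ Fin m) (Fin k ⊕ Fin m) ℝ)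
    (x : Fin k → ℝ) (a : Fin k) (b c : Fin m) : ℝ :=
  normalProj G x
    (fun i => partialDeriv a (fun y => normalFrame G b y i) x
      + ∑ j, christoffel G (onSlice x) i (Sum.inl a) j * normalFrame G b x j) (Sum.inr c)

/-- The covariant derivative `∇̄T`, for the induced connections on the tangent and the normal
bundle of the slice, of a tensor field `T_{α₁ … α_r}^{γ'}` with `r` tangential covariant indices
and values in the normal bundle; the index of differentiation is put last. -/
def covDerivNormal (G : Model k m → Matrix (Fin k ⊕ Fin m) (Fin k ⊕ Fin m) ℝ) {r : ℕ}
    (T : (Fin k → ℝ) → (Fin r → Fin k) → Fin m → ℝ)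
    (x : Fin k → ℝ) (I : Fin (r + 1) → Fin k) (c : Fin m) : ℝ :=
  partialDeriv (I (Fin.last r)) (fun y => T y (Fin.init I) c) x
    - ∑ s : Fin r, ∑ l,
        christoffel (inducedMetric G) x l (I (Fin.last r)) (Fin.init I s) *
          T x (Function.update (Fin.init I) s l) c
    + ∑ d, normalConnection G x (I (Fin.last r)) d c * T x (Fin.init I) d

/-- The iterated covariant derivative `∇̄^r L`. -/
def iterCovSecondFF (G : Model k m → Matrix (Fin k ⊕ Fin m) (Fin k ⊕ Fin m) ℝ) :
    (r : ℕ) → (Fin k → ℝ) → (Fin (2 + r) → Fin k) → Fin m → ℝ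
  | 0 => secondFF G
  | r + 1 => covDerivNormal G (iterCovSecondFF G r)

end Slice

/-- Names for the components of all `∇^r Rm` and of all `∇̄^r L`. -/
inductive CurvatureVar (k m : ℕ) : Type
  /-- The component of `∇^r Rm` with the (covariant) indices `I`. -/
  | rm (r : ℕ) (I : Fin (4 + r) → Fin k ⊕ Fin m) : CurvatureVar k m
  /-- The component of `∇̄^r L` with the tangential indices `I` and the normal index `c`. -/
  | sff (r : ℕ) (I : Fin (2 + r) → Fin k) (c : Fin m) : CurvatureVar k m

/-- The values at the origin of the components of all `∇^r Rm` and all `∇̄^r L`. -/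
def curvatureValue {k m : ℕ} (G : Model k m → Matrix (Fin k ⊕ Fin m) (Fin k ⊕ Fin m) ℝ) :
    CurvatureVar k m → ℝ
  | .rm r I => iterCovRiemann G r 0 I
  | .sff r I c => iterCovSecondFF G r 0 I c

/-! ### Pseudo-Riemannian manifolds -/

section Charts

variable {ι : Type} [Fintype ι] {M : Type*} [TopologicalSpace M] [ChartedSpace (ι → ℝ) M]

/-- The charts of the smooth structure of `M`. -/
def smoothCharts (ι : Type) [Fintype ι] (M : Type*) [TopologicalSpace M]
    [ChartedSpace (ι → ℝ) M] : Set (OpenPartialHomeomorph M (ι → ℝ)) :=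
  IsManifold.maximalAtlas 𝓘(ℝ, ι → ℝ) ∞ M

/-- The components in the chart `φ` of a tangent vector `v` at `q`. -/
def vectorComp (φ : OpenPartialHomeomorph M (ι → ℝ)) (q : M)
    (v : TangentSpace 𝓘(ℝ, ι → ℝ) q) : ι → ℝ :=
  mfderiv 𝓘(ℝ, ι → ℝ) 𝓘(ℝ, ι → ℝ) φ q v

/-- The coordinate vector `∂_i` of the chart `φ` at the point with coordinates `z`. -/
def coordVector [DecidableEq ι] (φ : OpenPartialHomeomorph M (ι → ℝ)) (z : ι → ℝ) (i : ι) :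
    TangentSpace 𝓘(ℝ, ι → ℝ) (φ.symm z) :=
  mfderiv 𝓘(ℝ, ι → ℝ) 𝓘(ℝ, ι → ℝ) φ.symm z (Pi.single i (1 : ℝ) : ι → ℝ)

end Charts

/-- A smooth pseudo-Riemannian metric (of any signature): a nondegenerate symmetric bilinear form
on each tangent space whose components in each chart are smooth. -/
structure PseudoRiemannianMetric (ι : Type) [Fintype ι] [DecidableEq ι] (M : Type*)
    [TopologicalSpace M] [ChartedSpace (ι → ℝ) M] where
  /-- The form on each tangent space. -/
  form : ∀ q : M, LinearMap.BilinForm ℝ (TangentSpace 𝓘(ℝ, ι → ℝ) q)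
  symm : ∀ q v w, form q v w = form q w v
  nondegenerate : ∀ q v, (∀ w, form q v w = 0) → v = 0
  smooth : ∀ φ ∈ smoothCharts ι M, ∀ i j,
    ContDiffOn ℝ ∞
      (fun z => form (φ.symm z) (coordVector φ z i) (coordVector φ z j)) φ.target

section Geodesics

variable {ι : Type} [Fintype ι] [DecidableEq ι] {M : Type*} [TopologicalSpace M]
  [ChartedSpace (ι → ℝ) M]

/-- The matrix of components `g_{ij} = g(∂_i, ∂_j)` of the metric in the chart `φ`. -/
def PseudoRiemannianMetric.comp (g : PseudoRiemannianMetric ι M)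
    (φ : OpenPartialHomeomorph M (ι → ℝ)) (z : ι → ℝ) : Matrix ι ι ℝ :=
  fun i j => g.form (φ.symm z) (coordVector φ z i) (coordVector φ z j)

/-- `γ` is a geodesic of `g` on the open set `J` of times: it is smooth there and satisfies the
geodesic equation `D_t γ' = 0` in every chart. -/
def IsGeodesicOn (g : PseudoRiemannianMetric ι M) (γ : ℝ → M) (J : Set ℝ) : Prop :=
  ContMDiffOn 𝓘(ℝ, ℝ) 𝓘(ℝ, ι → ℝ) ∞ γ J ∧
  ∀ ψ ∈ smoothCharts ι M, ∀ t ∈ J, γ t ∈ ψ.source →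
    covDerivAlong (g.comp ψ) (fun s => ψ (γ s)) (deriv fun s => ψ (γ s)) t = 0

/-- `exp_q v = q'`: there is a geodesic `γ` of `g`, defined on a neighbourhood of `[0, 1]`, with
`γ(0) = q`, `γ'(0) = v` and `γ(1) = q'`. -/
def IsExp (g : PseudoRiemannianMetric ι M) (q : M) (v : TangentSpace 𝓘(ℝ, ι → ℝ) q)
    (q' : M) : Prop :=
  ∃ (γ : ℝ → M) (J : Set ℝ), IsOpen J ∧ Set.Icc 0 1 ⊆ J ∧ IsGeodesicOn g γ J ∧
    tangentMap 𝓘(ℝ, ℝ) 𝓘(ℝ, ι → ℝ) γ ⟨(0 : ℝ), (1 : ℝ)⟩ = ⟨q, v⟩ ∧ γ 1 = q'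

end Geodesics

/-! ### Submanifolds -/

section Submanifolds

variable {k m : ℕ} {M : Type*} [TopologicalSpace M] [ChartedSpace (Model k m) M]

/-- The smooth charts `(x, u)` of `M` adapted to `S`, i.e. those in which `S = {u = 0}`. -/
def adaptedCharts (S : Set M) : Set (OpenPartialHomeomorph M (Model k m)) :=
  {ψ | ψ ∈ smoothCharts (Fin k ⊕ Fin m) M ∧
    ∀ q ∈ ψ.source, q ∈ S ↔ ∀ c : Fin m, ψ q (Sum.inr c) = 0}

/-- `S` is an embedded submanifold of `M` of dimension `k` and codimension `m`. -/
def IsEmbeddedSubmanifold (k m : ℕ) {M : Type*} [TopologicalSpace M]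
    [ChartedSpace (Model k m) M] (S : Set M) : Prop :=
  ∀ q ∈ S, ∃ ψ ∈ adaptedCharts (k := k) (m := m) S, q ∈ ψ.source

/-- `v ∈ T_q S`: in an adapted chart, the `u`-components of `v` vanish. -/
def IsTangentTo (S : Set M) (q : M) (v : TangentSpace 𝓘(ℝ, Model k m) q) : Prop :=
  ∃ ψ ∈ adaptedCharts (k := k) (m := m) S,
    q ∈ ψ.source ∧ ∀ c : Fin m, vectorComp ψ q v (Sum.inr c) = 0

/-- `v ∈ N_q S`, the orthogonal complement of `T_q S`. -/
def IsNormalTo (g : PseudoRiemannianMetric (Fin k ⊕ Fin m) M) (S : Set M) (q : M)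
    (v : TangentSpace 𝓘(ℝ, Model k m) q) : Prop :=
  ∀ w, IsTangentTo S q w → g.form q w v = 0

/-- The pullback of `g` to `S` is nondegenerate. -/
def IsNondegenerate (g : PseudoRiemannianMetric (Fin k ⊕ Fin m) M) (S : Set M) : Prop :=
  ∀ q ∈ S, ∀ v, IsTangentTo S q v → (∀ w, IsTangentTo S q w → g.form q v w = 0) → v = 0

/-- `γ` is, on the open set `J` of times, a geodesic in `S` of the pullback metric `i^*g`: it is a
smooth curve in `S` which satisfies the geodesic equation of `i^*g` in the coordinates `x` of
every adapted chart. -/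
def IsInducedGeodesicOn (g : PseudoRiemannianMetric (Fin k ⊕ Fin m) M) (S : Set M)
    (γ : ℝ → M) (J : Set ℝ) : Prop :=
  ContMDiffOn 𝓘(ℝ, ℝ) 𝓘(ℝ, Model k m) ∞ γ J ∧ (∀ t ∈ J, γ t ∈ S) ∧
  ∀ ψ ∈ adaptedCharts S, ∀ t ∈ J, γ t ∈ ψ.source →
    covDerivAlong (inducedMetric (g.comp ψ)) (fun s => tangentialPart (ψ (γ s)))
      (deriv fun s => tangentialPart (ψ (γ s))) t = 0

/-- `exp_q v = q'` for the exponential map of the pullback metric `i^*g` on `S`. -/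
def IsInducedExp (g : PseudoRiemannianMetric (Fin k ⊕ Fin m) M) (S : Set M) (q : M)
    (v : TangentSpace 𝓘(ℝ, Model k m) q) (q' : M) : Prop :=
  ∃ (γ : ℝ → M) (J : Set ℝ), IsOpen J ∧ Set.Icc 0 1 ⊆ J ∧ IsInducedGeodesicOn g S γ J ∧
    tangentMap 𝓘(ℝ, ℝ) 𝓘(ℝ, Model k m) γ ⟨(0 : ℝ), (1 : ℝ)⟩ = ⟨q, v⟩ ∧ γ 1 = q'

/-- Along the curve `γ` in `S`, for times in `[0, 1]`, the vector field `N` is a differentiable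
section of the normal bundle of `S` which is parallel for the induced connection:
`∇̄_{γ'} N = (∇_{γ'} N)^⊥ = 0`. -/
def IsParallelNormalAlong (g : PseudoRiemannianMetric (Fin k ⊕ Fin m) M) (S : Set M)
    (γ : ℝ → M) (N : ∀ q : M, TangentSpace 𝓘(ℝ, Model k m) q) : Prop :=
  ∀ t ∈ Set.Icc (0 : ℝ) 1, γ t ∈ S ∧ IsNormalTo g S (γ t) (N (γ t)) ∧
    ∀ ψ ∈ adaptedCharts S, γ t ∈ ψ.source →
      DifferentiableAt ℝ (fun s => vectorComp ψ (γ s) (N (γ s))) t ∧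
      normalProj (g.comp ψ) (tangentialPart (ψ (γ t)))
        (covDerivAlong (g.comp ψ) (fun s => ψ (γ s))
          (fun s => vectorComp ψ (γ s) (N (γ s))) t) = 0

/-- `e` consists of a frame `e_α` of `T_p S` and a frame `e_{α'}` of `N_p S` with
`g(e_α, e_β) = h_{αβ}` and `g(e_{α'}, e_{β'}) = h_{α'β'}`.  (Linear independence follows if `h` is
nondegenerate.) -/
structure IsAdaptedFrame (g : PseudoRiemannianMetric (Fin k ⊕ Fin m) M) (S : Set M) (p : M)
    (h₁ : Matrix (Fin k) (Fin k) ℝ) (h₂ : Matrix (Fin m) (Fin m) ℝ)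
    (e : Fin k ⊕ Fin m → TangentSpace 𝓘(ℝ, Model k m) p) : Prop where
  tangent : ∀ a, IsTangentTo S p (e (Sum.inl a))
  normal : ∀ c, IsNormalTo g S p (e (Sum.inr c))
  form_tangent : ∀ a b, g.form p (e (Sum.inl a)) (e (Sum.inl b)) = h₁ a b
  form_normal : ∀ c d, g.form p (e (Sum.inr c)) (e (Sum.inr d)) = h₂ c d

/-- `φ = (x, u)` is a submanifold geodesic normal coordinate system of `S ⊆ M` at `p` for the
frame `e`: it is an adapted chart with `φ(p) = 0`, and near `0`
* `x` are the geodesic normal coordinates of `i^*g` on `S`: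
  `φ⁻¹(x, 0) = exp_p^{i^*g}(x^α e_α)`;
* the `e_{α'}` are extended to sections `E_{α'}` of the normal bundle of `S` which are parallel
  along each radial geodesic `γ_x(t) = φ⁻¹(tx, 0)`;
* `u` are the Fermi coordinates relative to the `E_{α'}`, and `x` is constant along the normal
  geodesics: `φ⁻¹(x, u) = exp^g_{φ⁻¹(x, 0)}(u^{α'} E_{α'})`. -/
structure IsSubmanifoldNormalChart (g : PseudoRiemannianMetric (Fin k ⊕ Fin m) M) (S : Set M)
    (p : M) (e : Fin k ⊕ Fin m → TangentSpace 𝓘(ℝ, Model k m) p)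
    (φ : OpenPartialHomeomorph M (Model k m)) : Prop where
  adapted : φ ∈ adaptedCharts S
  mem_source : p ∈ φ.source
  map_point : φ p = 0
  tangential : ∀ᶠ x : Fin k → ℝ in 𝓝 0,
    IsInducedExp g S p (∑ a, x a • e (Sum.inl a)) (φ.symm (onSlice x))
  normal : ∃ E : Fin m → ∀ q : M, TangentSpace 𝓘(ℝ, Model k m) q,
    (∀ c, E c p = e (Sum.inr c)) ∧
    (∀ᶠ x : Fin k → ℝ in 𝓝 0, ∀ c,
      IsParallelNormalAlong g S (fun t => φ.symm (onSlice (t • x))) (E c)) ∧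
    (∀ᶠ z : Model k m in 𝓝 0,
      IsExp g (φ.symm (onSlice (tangentialPart z)))
        (∑ c, z (Sum.inr c) • E c (φ.symm (onSlice (tangentialPart z)))) (φ.symm z))

end Submanifolds

end SubmanifoldNormal

end

set_option linter.unusedSectionVars false


namespace SubmanifoldNormal

/-! ### Calculus of partial derivatives of smooth germs -/

section Calculus

variable {ι : Type} [Fintype ι] [DecidableEq ι] {f g : (ι → ℝ) → ℝ} {x : ι → ℝ}

/-! The proof has an algebraic half and a geometric half, joined by the gauge conditions
`IsNormalMetric`. In the chart, the metric is block diagonal along the slice, the rays `t ↦ (tx, 0)`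
are geodesics of the pullback metric, the `∂_{α'}` are parallel along these rays, and the lines `t ↦
(x, tu)` are geodesics.

Algebraic half. Let `A` be the subalgebra, generated by the components at the origin of all `∇^r Rm`
and `∇̄^r L`, of the real functions on the set of all metrics in this gauge with a fixed `h`. Since
`A` is the range of an evaluation map, membership in `A` is the existence of one polynomial valid
for every metric. The Taylor coefficients of `g` are placed in `A` by induction on the order
(`jetsIn_metric`). Suppose those of order at most `N` lie in `A`. Then the Christoffel symbols are
known to order `N - 1`. This suffices for the jets of `Rm` and `L` to order `N`, because a partial
derivative differs from a covariant one by terms linear in Christoffel symbols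
(`jetsIn_iterCovRiemann`, `jetsIn_iterCovSecondFF`). The curvature formula then makes `∂_K Γ^i_{lj}`
with `|K| = N` symmetric modulo `A` in all its lower indices `l, j, K` (`christoffelJet_perm`), so
only the multiset `J` of these indices matters, and it can be arranged to suit one of the gauge
conditions. With two normal indices in `J`, the normal geodesic equation is used. With one, the
parallel frame is used if `i` is normal, and `L` if `i` is tangential. With none, `L` is used if `i`
is normal, and the radial geodesic equation if `i` is tangential. Differentiating an equation such
as `u^a u^b Γ^i_{ab} = 0` by `∂_J` at the origin gives a positive multiple of the symmetrized jet
(`exists_iterPartial_radial`), which therefore lies in `A`. Finally `∂g = gΓ + gΓ` gives `g` to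
order `N + 1`.

Geometric half. The exponential maps are given pointwise, with a separate geodesic for each vector.
Uniqueness of geodesics together with rescaling shows that a single geodesic passes through all the
points `exp (s v)` (`exists_ray`). In the chart this geodesic is a straight line, and its equation
and initial velocity yield the gauge conditions (`IsSubmanifoldNormalChart.isNormalMetric`). -/

theorem contDiffAt_partialDeriv (hf : ContDiffAt ℝ ∞ f x) (i : ι) :
    ContDiffAt ℝ ∞ (partialDeriv i f) x :=
  (hf.fderiv_right (m := ∞) (by simp)).clm_apply contDiffAt_const

theorem contDiffAt_iterPartial (hf : ContDiffAt ℝ ∞ f x) (K : List ι) :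
    ContDiffAt ℝ ∞ (iterPartial K f) x := by
  induction K with
  | nil => exact hf
  | cons i K ih => exact contDiffAt_partialDeriv ih i

theorem eventually_differentiableAt (hf : ContDiffAt ℝ ∞ f x) :
    ∀ᶠ y in 𝓝 x, DifferentiableAt ℝ f y := by
  filter_upwards [(hf.of_le (m := 1) (by exact_mod_cast le_top)).eventually (by decide)] with y hy
  exact hy.differentiableAt (by decide)

theorem partialDeriv_congr (h : f =ᶠ[𝓝 x] g) (i : ι) :
    partialDeriv i f =ᶠ[𝓝 x] partialDeriv i g := by
  filter_upwards [h.fderiv (𝕜 := ℝ)] with y hy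
  simp only [partialDeriv, hy]

theorem iterPartial_congr (h : f =ᶠ[𝓝 x] g) (K : List ι) :
    iterPartial K f =ᶠ[𝓝 x] iterPartial K g := by
  induction K with
  | nil => exact h
  | cons i K ih => exact partialDeriv_congr ih i

theorem iterPartial_append (K K' : List ι) (f : (ι → ℝ) → ℝ) :
    iterPartial (K ++ K') f = iterPartial K (iterPartial K' f) :=
  List.foldr_append

theorem iterPartial_concat (K : List ι) (i : ι) (f : (ι → ℝ) → ℝ) :
    iterPartial (K ++ [i]) f = iterPartial K (partialDeriv i f) :=
  iterPartial_append K [i] f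

theorem partialDeriv_const (i : ι) (r : ℝ) : partialDeriv i (fun _ => r) = fun _ => 0 := by
  funext z
  simp [partialDeriv]

theorem partialDeriv_add (hf : ContDiffAt ℝ ∞ f x) (hg : ContDiffAt ℝ ∞ g x) (i : ι) :
    partialDeriv i (fun z => f z + g z)
      =ᶠ[𝓝 x] fun z => partialDeriv i f z + partialDeriv i g z := by
  filter_upwards [eventually_differentiableAt hf, eventually_differentiableAt hg] with y h₁ h₂
  simp [partialDeriv, fderiv_fun_add h₁ h₂]

theorem partialDeriv_mul (hf : ContDiffAt ℝ ∞ f x) (hg : ContDiffAt ℝ ∞ g x) (i : ι) :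
    partialDeriv i (fun z => f z * g z)
      =ᶠ[𝓝 x] fun z => partialDeriv i f z * g z + f z * partialDeriv i g z := by
  filter_upwards [eventually_differentiableAt hf, eventually_differentiableAt hg] with y h₁ h₂
  simp [partialDeriv, fderiv_fun_mul h₁ h₂]
  ring

theorem partialDeriv_sum {κ : Type*} {s : Finset κ} {F : κ → (ι → ℝ) → ℝ}
    (hF : ∀ a ∈ s, ContDiffAt ℝ ∞ (F a) x) (i : ι) :
    partialDeriv i (fun z => ∑ a ∈ s, F a z)
      =ᶠ[𝓝 x] fun z => ∑ a ∈ s, partialDeriv i (F a) z := by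
  have h : ∀ᶠ y in 𝓝 x, ∀ a ∈ s, DifferentiableAt ℝ (F a) y :=
    (Filter.eventually_all_finset s).2 fun a ha => eventually_differentiableAt (hF a ha)
  filter_upwards [h] with y hy
  simp [partialDeriv, fderiv_fun_sum hy]

theorem partialDeriv_inv (hf : ContDiffAt ℝ ∞ f x) (h0 : f x ≠ 0) (i : ι) :
    partialDeriv i (fun z => (f z)⁻¹)
      =ᶠ[𝓝 x] fun z => (-1) * ((f z)⁻¹ * (f z)⁻¹) * partialDeriv i f z := by
  filter_upwards [eventually_differentiableAt hf,
    hf.continuousAt.eventually_ne h0] with y hy hy0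
  have h := (hasDerivAt_inv hy0).comp_hasFDerivAt y hy.hasFDerivAt
  simp only [partialDeriv]
  erw [h.fderiv]
  rw [smul_apply, smul_eq_mul, sq, mul_inv]
  ring

theorem partialDeriv_coord (a i : ι) :
    partialDeriv i (fun z : ι → ℝ => z a) = fun _ => if a = i then 1 else 0 := by
  funext z
  have h : HasFDerivAt (fun z : ι → ℝ => z a) (ContinuousLinearMap.proj (R := ℝ) a) z :=
    (ContinuousLinearMap.proj (R := ℝ) (φ := fun _ : ι => ℝ) a).hasFDerivAt
  simp [partialDeriv, h.fderiv, Pi.single_apply]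

theorem contDiffAt_coord (a : ι) : ContDiffAt ℝ ∞ (fun z : ι → ℝ => z a) x :=
  contDiffAt_apply ℝ ℝ a x

theorem partialDeriv_comm (hf : ContDiffAt ℝ ∞ f x) (i j : ι) :
    partialDeriv i (partialDeriv j f) =ᶠ[𝓝 x] partialDeriv j (partialDeriv i f) := by
  have h2 : ContDiffAt ℝ 2 f x := hf.of_le (WithTop.coe_le_coe.2 le_top)
  filter_upwards [h2.eventually (by decide)] with y hy
  have hs := hy.isSymmSndFDerivAt (by simp)
  have hd : DifferentiableAt ℝ (fderiv ℝ f) y :=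
    (hy.fderiv_right (m := 1) (by norm_num)).differentiableAt (by decide)
  have key : ∀ a b : ι, partialDeriv a (partialDeriv b f) y
      = fderiv ℝ (fderiv ℝ f) y (Pi.single a 1) (Pi.single b 1) := by
    intro a b
    have h := hd.hasFDerivAt.clm_apply
      (hasFDerivAt_const (Pi.single b 1 : ι → ℝ) y)
    change fderiv ℝ (fun z => fderiv ℝ f z (Pi.single b 1)) y (Pi.single a 1) = _
    rw [h.fderiv]
    simp
  rw [key, key]
  exact hs _ _

theorem iterPartial_perm (hf : ContDiffAt ℝ ∞ f x) {K K' : List ι} (h : K.Perm K') :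
    iterPartial K f =ᶠ[𝓝 x] iterPartial K' f := by
  induction h with
  | nil => exact Filter.EventuallyEq.rfl
  | cons i _ ih => exact partialDeriv_congr ih i
  | swap i j K => exact partialDeriv_comm (contDiffAt_iterPartial hf K) j i
  | trans _ _ h₁ h₂ => exact h₁.trans h₂

theorem iterPartial_add (hf : ContDiffAt ℝ ∞ f x) (hg : ContDiffAt ℝ ∞ g x) (K : List ι) :
    iterPartial K (fun z => f z + g z)
      =ᶠ[𝓝 x] fun z => iterPartial K f z + iterPartial K g z := by
  induction K with
  | nil => exact Filter.EventuallyEq.rfl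
  | cons i K ih =>
    exact (partialDeriv_congr ih i).trans
      (partialDeriv_add (contDiffAt_iterPartial hf K) (contDiffAt_iterPartial hg K) i)

theorem iterPartial_zero (K : List ι) : iterPartial K (fun _ => 0) = fun _ => 0 := by
  induction K with
  | nil => rfl
  | cons i K ih =>
    change partialDeriv i (iterPartial K fun _ => 0) = _
    rw [ih, partialDeriv_const]

theorem contDiffAt_det {κ : Type*} [Fintype κ] [DecidableEq κ]
    {M : (ι → ℝ) → Matrix κ κ ℝ} (h : ∀ a b, ContDiffAt ℝ ∞ (fun z => M z a b) x) :
    ContDiffAt ℝ ∞ (fun z => (M z).det) x := by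
  simp only [Matrix.det_apply']
  exact ContDiffAt.sum fun σ _ => contDiffAt_const.mul (contDiffAt_prod fun a _ => h _ _)

/-- Cramer's rule reduces smoothness and jets of the inverse matrix to those of determinants and of
one scalar inverse. -/
theorem inv_apply_eq {κ : Type*} [Fintype κ] [DecidableEq κ] (M : Matrix κ κ ℝ) (a b : κ) :
    M⁻¹ a b = M.det⁻¹ * (M.updateRow b (Pi.single a 1)).det := by
  rw [Matrix.inv_def, Ring.inverse_eq_inv', Matrix.smul_apply, Matrix.adjugate_apply, smul_eq_mul]

theorem contDiffAt_inv_apply {κ : Type*} [Fintype κ] [DecidableEq κ]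
    {M : (ι → ℝ) → Matrix κ κ ℝ} (h : ∀ a b, ContDiffAt ℝ ∞ (fun z => M z a b) x)
    (h0 : (M x).det ≠ 0) (a b : κ) : ContDiffAt ℝ ∞ (fun z => (M z)⁻¹ a b) x := by
  simp only [inv_apply_eq]
  refine ((contDiffAt_det h).inv h0).mul (contDiffAt_det fun c d => ?_)
  simp only [Matrix.updateRow_apply]
  split_ifs
  · exact contDiffAt_const
  · exact h c d

theorem contDiffAt_christoffel {G : (ι → ℝ) → Matrix ι ι ℝ}
    (h : ∀ a b, ContDiffAt ℝ ∞ (fun z => G z a b) x) (h0 : (G x).det ≠ 0) (l i j : ι) :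
    ContDiffAt ℝ ∞ (fun z => christoffel G z l i j) x := by
  unfold christoffel
  exact contDiffAt_const.mul (ContDiffAt.sum fun s _ => (contDiffAt_inv_apply h h0 l s).mul
    (((contDiffAt_partialDeriv (h j s) i).add (contDiffAt_partialDeriv (h i s) j)).sub
      (contDiffAt_partialDeriv (h i j) s)))

end Calculus

/-! ### Families of germs with all jets in a subalgebra -/

section Jets

variable {C : Type*} {ι : Type} [Fintype ι] [DecidableEq ι]

/-- All partial derivatives of order at most `N` at the origin of the family `f` of smooth germs
lie in the algebra `A` of functions of the parameter. -/
structure JetsIn (A : Subalgebra ℝ (C → ℝ)) (N : ℕ) (f : C → (ι → ℝ) → ℝ) : Prop where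
  smooth : ∀ c, ContDiffAt ℝ ∞ (f c) 0
  mem : ∀ K : List ι, K.length ≤ N → (fun c => iterPartial K (f c) 0) ∈ A

namespace JetsIn

variable {A : Subalgebra ℝ (C → ℝ)} {N : ℕ} {f g : C → (ι → ℝ) → ℝ}

theorem mono {N' : ℕ} (h : JetsIn A N f) (hN : N' ≤ N) : JetsIn A N' f :=
  ⟨h.smooth, fun K hK => h.mem K (hK.trans hN)⟩

theorem congr (h : JetsIn A N f) (hfg : ∀ c, f c =ᶠ[𝓝 0] g c) : JetsIn A N g := by
  refine ⟨fun c => (h.smooth c).congr_of_eventuallyEq (hfg c).symm, fun K hK => ?_⟩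
  have := h.mem K hK
  simpa only [fun c => (iterPartial_congr (hfg c) K).eq_of_nhds] using this

theorem zero_iff : JetsIn A 0 f ↔ (∀ c, ContDiffAt ℝ ∞ (f c) 0) ∧ (fun c => f c 0) ∈ A := by
  refine ⟨fun h => ⟨h.smooth, h.mem [] le_rfl⟩, fun h => ⟨h.1, fun K hK => ?_⟩⟩
  obtain rfl := List.length_eq_zero_iff.1 (Nat.le_zero.1 hK)
  exact h.2

/-- Splitting off the derivative that acts first, which is the last entry of the list, allows
closure properties to be proved by induction on the order from the rules for one derivative. -/
theorem succ_iff : JetsIn A (N + 1) f ↔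
    (∀ c, ContDiffAt ℝ ∞ (f c) 0) ∧ (fun c => f c 0) ∈ A ∧
      ∀ i, JetsIn A N fun c => partialDeriv i (f c) := by
  refine ⟨fun h => ⟨h.smooth, h.mem [] (Nat.zero_le _), fun i =>
    ⟨fun c => contDiffAt_partialDeriv (h.smooth c) i, fun K hK => ?_⟩⟩,
    fun ⟨h₁, h₂, h₃⟩ => ⟨h₁, fun K hK => ?_⟩⟩
  · simpa only [iterPartial_concat] using h.mem (K ++ [i]) (by simpa using hK)
  · rcases List.eq_nil_or_concat' K with rfl | ⟨K, i, rfl⟩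
    · exact h₂
    · simpa only [iterPartial_concat] using (h₃ i).mem K (by simpa using hK)

theorem deriv (h : JetsIn A (N + 1) f) (i : ι) : JetsIn A N fun c => partialDeriv i (f c) :=
  (succ_iff.1 h).2.2 i

theorem const {r : C → ℝ} (hr : r ∈ A) : JetsIn A N fun c (_ : ι → ℝ) => r c := by
  induction N generalizing r with
  | zero => exact zero_iff.2 ⟨fun _ => contDiffAt_const, hr⟩
  | succ N ih =>
    refine succ_iff.2 ⟨fun _ => contDiffAt_const, hr, fun i => ?_⟩
    simp only [partialDeriv_const]
    exact ih A.zero_mem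

theorem const_real (r : ℝ) : JetsIn A N fun _ (_ : ι → ℝ) => r :=
  const (A.algebraMap_mem r)

theorem add (hf : JetsIn A N f) (hg : JetsIn A N g) : JetsIn A N fun c z => f c z + g c z := by
  refine ⟨fun c => (hf.smooth c).add (hg.smooth c), fun K hK => ?_⟩
  simp only [fun c => (iterPartial_add (hf.smooth c) (hg.smooth c) K).eq_of_nhds]
  exact A.add_mem (hf.mem K hK) (hg.mem K hK)

theorem sum {κ : Type*} {s : Finset κ} {F : κ → C → (ι → ℝ) → ℝ}
    (h : ∀ a ∈ s, JetsIn A N (F a)) : JetsIn A N fun c z => ∑ a ∈ s, F a c z := by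
  classical
  induction s using Finset.induction_on with
  | empty => simpa using const_real (A := A) (N := N) (ι := ι) 0
  | insert a s ha ih =>
    simp only [Finset.sum_insert ha]
    exact (h a (by simp)).add (ih fun b hb => h b (by simp [hb]))

theorem mul (hf : JetsIn A N f) (hg : JetsIn A N g) : JetsIn A N fun c z => f c z * g c z := by
  induction N generalizing f g with
  | zero =>
    exact zero_iff.2 ⟨fun c => (hf.smooth c).mul (hg.smooth c),
      A.mul_mem (zero_iff.1 hf).2 (zero_iff.1 hg).2⟩
  | succ N ih =>
    refine succ_iff.2 ⟨fun c => (hf.smooth c).mul (hg.smooth c),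
      A.mul_mem (succ_iff.1 hf).2.1 (succ_iff.1 hg).2.1, fun i => ?_⟩
    exact ((ih (hf.deriv i) (hg.mono N.le_succ)).add (ih (hf.mono N.le_succ) (hg.deriv i))).congr
      fun c => (partialDeriv_mul (hf.smooth c) (hg.smooth c) i).symm

theorem neg (hf : JetsIn A N f) : JetsIn A N fun c z => -f c z :=
  ((const_real (-1)).mul hf).congr fun c => by simp

theorem sub (hf : JetsIn A N f) (hg : JetsIn A N g) : JetsIn A N fun c z => f c z - g c z := by
  simpa only [sub_eq_add_neg] using hf.add hg.neg

theorem prod {κ : Type*} {s : Finset κ} {F : κ → C → (ι → ℝ) → ℝ}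
    (h : ∀ a ∈ s, JetsIn A N (F a)) : JetsIn A N fun c z => ∏ a ∈ s, F a c z := by
  classical
  induction s using Finset.induction_on with
  | empty => simpa using const_real (A := A) (N := N) (ι := ι) 1
  | insert a s ha ih =>
    simp only [Finset.prod_insert ha]
    exact (h a (by simp)).mul (ih fun b hb => h b (by simp [hb]))

/-- The algebra need not be closed under inverses, so the value at the origin is a hypothesis.
Higher orders follow from `∂(f⁻¹) = -f⁻¹ f⁻¹ ∂f`, which involves `f⁻¹` only to lower order. -/
theorem inv (hf : JetsIn A N f) (h0 : ∀ c, f c 0 ≠ 0) (hA : (fun c => (f c 0)⁻¹) ∈ A) :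
    JetsIn A N fun c z => (f c z)⁻¹ := by
  induction N with
  | zero => exact zero_iff.2 ⟨fun c => (hf.smooth c).inv (h0 c), hA⟩
  | succ N ih =>
    have h := ih (hf.mono N.le_succ)
    refine succ_iff.2 ⟨fun c => (hf.smooth c).inv (h0 c), hA, fun i => ?_⟩
    exact (((const_real (-1)).mul (h.mul h)).mul (hf.deriv i)).congr
      fun c => (partialDeriv_inv (hf.smooth c) (h0 c) i).symm

theorem det {κ : Type*} [Fintype κ] [DecidableEq κ] {M : C → (ι → ℝ) → Matrix κ κ ℝ}
    (h : ∀ a b, JetsIn A N fun c z => M c z a b) : JetsIn A N fun c z => (M c z).det := by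
  simp only [Matrix.det_apply']
  exact sum fun σ _ => (const_real _).mul (prod fun a _ => h _ _)

/-- The determinant at the origin is the same for the whole family, so its inverse is a constant and
hence in `A`. For metrics in the gauge this holds because `G 0` is prescribed. -/
theorem matrix_inv {κ : Type*} [Fintype κ] [DecidableEq κ] {M : C → (ι → ℝ) → Matrix κ κ ℝ}
    (h : ∀ a b, JetsIn A N fun c z => M c z a b) {r : ℝ} (hr : r ≠ 0)
    (h0 : ∀ c, (M c 0).det = r) (a b : κ) : JetsIn A N fun c z => (M c z)⁻¹ a b := by
  simp only [inv_apply_eq]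
  refine ((det h).inv (fun c => (h0 c).trans_ne hr) ?_).mul (det fun c d => ?_)
  · simp only [h0]
    exact A.algebraMap_mem r⁻¹
  · simp only [Matrix.updateRow_apply]
    split_ifs
    · exact const_real _
    · exact h c d

end JetsIn

/-- If the mixed derivatives of the `f a` at the origin are multiples of `v` modulo `A`, then so
are those of `∑ a, z a * f a`, and the multiplicity is at least the total weight of the indices of
differentiation. -/
theorem exists_iterPartial_radial {A : Subalgebra ℝ (C → ℝ)} {v : C → ℝ} (w : ι → ℕ)
    (J : List ι) (f : ι → C → (ι → ℝ) → ℝ) (hf : ∀ a c, ContDiffAt ℝ ∞ (f a c) 0)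
    (h : ∀ a K, (a :: K).Perm J →
      ∃ n : ℕ, w a ≤ n ∧ (fun c => iterPartial K (f a c) 0) - (n : ℝ) • v ∈ A) :
    ∃ n : ℕ, (J.map w).sum ≤ n ∧
      (fun c => iterPartial J (fun z => ∑ a, z a * f a c z) 0) - (n : ℝ) • v ∈ A := by
  induction hJ : J.length generalizing J f with
  | zero =>
    obtain rfl := List.length_eq_zero_iff.1 hJ
    refine ⟨0, by simp, ?_⟩
    simp only [iterPartial, List.foldr_nil, Pi.zero_apply, zero_mul, Finset.sum_const_zero,
      Nat.cast_zero, zero_smul, sub_zero]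
    exact A.zero_mem
  | succ N ih =>
    rcases List.eq_nil_or_concat' J with rfl | ⟨J, j, rfl⟩
    · simp at hJ
    have hd : ∀ c, ContDiffAt ℝ ∞ (fun z : ι → ℝ => ∑ a, z a * partialDeriv j (f a c) z) 0 :=
      fun c => ContDiffAt.sum fun a _ =>
        (contDiffAt_coord a).mul (contDiffAt_partialDeriv (hf a c) j)
    -- Product rule for the derivative that acts first: either it removes the factor `z j`, or it
    -- falls on the `f a` and leaves a sum of the same form with a shorter list.
    have key : ∀ c, iterPartial (J ++ [j]) (fun z => ∑ a, z a * f a c z) 0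
        = iterPartial J (f j c) 0
          + iterPartial J (fun z => ∑ a, z a * partialDeriv j (f a c) z) 0 := by
      intro c
      rw [iterPartial_concat, ← (iterPartial_add (hf j c) (hd c) J).eq_of_nhds]
      refine (iterPartial_congr ?_ J).eq_of_nhds
      refine (partialDeriv_sum (fun a _ => (contDiffAt_coord a).mul (hf a c)) j).trans ?_
      have h' : ∀ᶠ z in 𝓝 (0 : ι → ℝ), ∀ a, partialDeriv j (fun z => z a * f a c z) z
          = (if a = j then 1 else 0) * f a c z + z a * partialDeriv j (f a c) z := by
        refine Filter.eventually_all.2 fun a => ?_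
        filter_upwards [partialDeriv_mul (contDiffAt_coord a) (hf a c) j] with z hz
        rw [hz, partialDeriv_coord]
      filter_upwards [h'] with z hz
      simp [hz, Finset.sum_add_distrib]
    obtain ⟨n₁, hn₁, h₁⟩ := h j J (List.perm_append_comm (l₁ := [j]))
    obtain ⟨n₂, hn₂, h₂⟩ := ih J (fun a c => partialDeriv j (f a c))
      (fun a c => contDiffAt_partialDeriv (hf a c) j) (fun a K hK => by
        simpa only [iterPartial_concat] using h a (K ++ [j]) (hK.append_right [j]))
      (by simpa using hJ)
    refine ⟨n₁ + n₂, by simp; omega, ?_⟩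
    simp only [key]
    convert A.add_mem h₁ h₂ using 1
    funext c
    simp
    ring

/-- A vector a positive multiple of which lies in `A` lies in `A`. -/
theorem mem_of_radial_eq_zero {A : Subalgebra ℝ (C → ℝ)} {v : C → ℝ} {n : ℕ} {F : C → ℝ}
    (hn : 1 ≤ n) (h : F - (n : ℝ) • v ∈ A) (hF : ∀ c, F c = 0) : v ∈ A := by
  have hn0 : (n : ℝ) ≠ 0 := by positivity
  convert A.smul_mem h (-(n : ℝ)⁻¹) using 1
  funext c
  simp [hF, hn0]

end Jets

end SubmanifoldNormal

namespace SubmanifoldNormal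

/-! ### Christoffel symbols and the metric -/

section Christoffel

variable {ι : Type} [Fintype ι] [DecidableEq ι] {G : (ι → ℝ) → Matrix ι ι ℝ} {z : ι → ℝ}

theorem christoffel_symm (h : ∀ᶠ y in 𝓝 z, ∀ i j, G y i j = G y j i) (l i j : ι) :
    christoffel G z l i j = christoffel G z l j i := by
  have hs : ∀ s, partialDeriv s (fun y => G y i j) z = partialDeriv s (fun y => G y j i) z :=
    fun s => (partialDeriv_congr (h.mono fun y hy => hy i j) s).eq_of_nhds
  simp only [christoffel, hs]
  congr 1
  exact Finset.sum_congr rfl fun s _ => by ring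

/-- With the upper index lowered, no inverse matrix remains. Identities between Christoffel symbols
are proved in this form and then transferred by nondegeneracy. -/
theorem sum_mul_christoffel (h0 : (G z).det ≠ 0) (q i j : ι) :
    ∑ l, G z q l * christoffel G z l i j = (1 / 2 : ℝ) *
      (partialDeriv i (fun y => G y j q) z + partialDeriv j (fun y => G y i q) z
        - partialDeriv q (fun y => G y i j) z) := by
  have hinv : ∀ s, ∑ l, G z q l * (G z)⁻¹ l s = (1 : Matrix ι ι ℝ) q s := fun s => by
    rw [← Matrix.mul_apply, Matrix.mul_nonsing_inv _ (isUnit_iff_ne_zero.2 h0)]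
  simp only [christoffel, Finset.mul_sum]
  rw [Finset.sum_comm]
  have : ∀ s, ∑ l, G z q l * (1 / 2 * ((G z)⁻¹ l s *
      (partialDeriv i (fun y => G y j s) z + partialDeriv j (fun y => G y i s) z
        - partialDeriv s (fun y => G y i j) z)))
      = (1 : Matrix ι ι ℝ) q s * (1 / 2 *
      (partialDeriv i (fun y => G y j s) z + partialDeriv j (fun y => G y i s) z
        - partialDeriv s (fun y => G y i j) z)) := fun s => by
    rw [← hinv s, Finset.sum_mul]
    exact Finset.sum_congr rfl fun l _ => by ring
  rw [Finset.sum_congr rfl fun s _ => this s]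
  simp [Matrix.one_apply]

/-- Compatibility of the Levi-Civita connection with the metric. -/
theorem partialDeriv_metric (h : ∀ᶠ y in 𝓝 z, ∀ i j, G y i j = G y j i)
    (h0 : (G z).det ≠ 0) (s i j : ι) :
    partialDeriv s (fun y => G y i j) z =
      ∑ l, (G z i l * christoffel G z l s j + G z j l * christoffel G z l s i) := by
  have hs : ∀ s i j, partialDeriv s (fun y => G y i j) z = partialDeriv s (fun y => G y j i) z :=
    fun s i j => (partialDeriv_congr (h.mono fun y hy => hy i j) s).eq_of_nhds
  rw [Finset.sum_add_distrib, sum_mul_christoffel h0, sum_mul_christoffel h0, hs s j i,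
    hs i s j, hs j s i]
  ring

theorem eq_of_forall_sum_eq {M : Matrix ι ι ℝ} (h0 : M.det ≠ 0) {v w : ι → ℝ}
    (h : ∀ q, ∑ l, M q l * v l = ∑ l, M q l * w l) : v = w :=
  Matrix.mulVec_injective_of_isUnit ((Matrix.isUnit_iff_isUnit_det _).2 (isUnit_iff_ne_zero.2 h0))
    (funext h)

theorem eq_sum_inv_mul {M : Matrix ι ι ℝ} (h0 : M.det ≠ 0) {v w : ι → ℝ}
    (h : ∀ q, ∑ l, M q l * v l = w q) (q : ι) : v q = ∑ l, M⁻¹ q l * w l := by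
  have hv : M.mulVec v = w := funext h
  have : M⁻¹.mulVec w = v := by
    rw [← hv, Matrix.mulVec_mulVec, Matrix.nonsing_inv_mul _ (isUnit_iff_ne_zero.2 h0),
      Matrix.one_mulVec]
  rw [← this]
  rfl

theorem JetsIn.christoffel {C : Type*} {A : Subalgebra ℝ (C → ℝ)} {N : ℕ}
    {M : C → (ι → ℝ) → Matrix ι ι ℝ} (h : ∀ a b, JetsIn A (N + 1) fun c z => M c z a b)
    {r : ℝ} (hr : r ≠ 0) (h0 : ∀ c, (M c 0).det = r) (l i j : ι) :
    JetsIn A N fun c z => christoffel (M c) z l i j := by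
  unfold SubmanifoldNormal.christoffel
  exact (const_real _).mul (sum fun s _ =>
    (matrix_inv (fun a b => (h a b).mono N.le_succ) hr h0 l s).mul
      ((((h j s).deriv i).add ((h i s).deriv j)).sub ((h i j).deriv s)))

/-- The polynomial variables are components of the covariant tensor, whereas the symmetry argument
for the Christoffel jets needs the upper-index curvature. -/
theorem riemann_eq_curvature (h0 : (G z).det ≠ 0) (i j a b : ι) :
    curvature G z i j a b = ∑ s, (G z)⁻¹ i s * riemann G z ![s, j, a, b] :=
  eq_sum_inv_mul h0 (v := fun s => curvature G z s j a b) (fun _ => rfl) i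

theorem contDiffAt_riemann (h : ∀ a b, ContDiffAt ℝ ∞ (fun y => G y a b) z)
    (h0 : (G z).det ≠ 0) (I : Fin 4 → ι) : ContDiffAt ℝ ∞ (fun y => riemann G y I) z := by
  unfold riemann curvature
  have hΓ := contDiffAt_christoffel h h0
  exact ContDiffAt.sum fun s _ => (h _ _).mul (((contDiffAt_partialDeriv (hΓ _ _ _) _).sub
    (contDiffAt_partialDeriv (hΓ _ _ _) _)).add (ContDiffAt.sum fun t _ =>
      ((hΓ _ _ _).mul (hΓ _ _ _)).sub ((hΓ _ _ _).mul (hΓ _ _ _))))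

theorem contDiffAt_iterCovRiemann (h : ∀ a b, ContDiffAt ℝ ∞ (fun y => G y a b) z)
    (h0 : (G z).det ≠ 0) (r : ℕ) (I : Fin (4 + r) → ι) :
    ContDiffAt ℝ ∞ (fun y => iterCovRiemann G r y I) z := by
  induction r with
  | zero => exact contDiffAt_riemann h h0 I
  | succ r ih =>
    exact (contDiffAt_partialDeriv (ih _) _).sub (ContDiffAt.sum fun s _ =>
      ContDiffAt.sum fun l _ => (contDiffAt_christoffel h h0 _ _ _).mul (ih _))

/-- The definition of the covariant derivative, solved for the partial derivative. This recursion
exchanges one order of differentiation for one more `∇`. -/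
theorem partialDeriv_iterCovRiemann (r : ℕ) (I : Fin (4 + r) → ι) (i : ι) :
    partialDeriv i (fun y => iterCovRiemann G r y I) z =
      iterCovRiemann G (r + 1) z (Fin.snoc (α := fun _ => ι) I i) +
        ∑ s : Fin (4 + r), ∑ l, christoffel G z l i (I s) *
          iterCovRiemann G r z (Function.update I s l) := by
  simp only [iterCovRiemann, covDeriv]
  erw [Fin.snoc_last, Fin.init_snoc]
  exact (sub_add_cancel _ _).symm

end Christoffel

/-! ### Restriction to the slice -/

section Slice

variable {k m : ℕ}

/-- The inclusion `x ↦ (x, 0)` as a continuous linear map. -/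
def onSliceL (k m : ℕ) : (Fin k → ℝ) →L[ℝ] Model k m :=
  ContinuousLinearMap.pi (Sum.elim (fun a => ContinuousLinearMap.proj a) fun _ => 0)

theorem onSliceL_apply (x : Fin k → ℝ) : onSliceL k m x = onSlice x := by
  funext i
  cases i <;> rfl

theorem onSlice_zero : onSlice (m := m) (0 : Fin k → ℝ) = 0 := by
  rw [← onSliceL_apply, map_zero]

theorem contDiff_onSlice : ContDiff ℝ ∞ (onSlice : (Fin k → ℝ) → Model k m) := by
  simpa only [← funext onSliceL_apply] using (onSliceL k m).contDiff

theorem continuous_onSlice : Continuous (onSlice : (Fin k → ℝ) → Model k m) :=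
  contDiff_onSlice.continuous

theorem tendsto_onSlice : Filter.Tendsto (onSlice : (Fin k → ℝ) → Model k m) (𝓝 0) (𝓝 0) := by
  simpa only [onSlice_zero] using (continuous_onSlice (k := k) (m := m)).tendsto 0

theorem onSlice_single (a : Fin k) :
    onSlice (m := m) (Pi.single a (1 : ℝ)) = Pi.single (Sum.inl a) 1 := by
  funext i
  cases i <;> simp [onSlice, Pi.single_apply]

theorem partialDeriv_onSlice {f : Model k m → ℝ} {x : Fin k → ℝ}
    (hf : DifferentiableAt ℝ f (onSlice x)) (a : Fin k) :
    partialDeriv a (fun y => f (onSlice y)) x = partialDeriv (Sum.inl a) f (onSlice x) := by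
  rw [← onSliceL_apply] at hf
  have h := hf.hasFDerivAt.comp x (onSliceL k m).hasFDerivAt
  have h' : HasFDerivAt (fun y => f (onSlice y))
      ((fderiv ℝ f (onSliceL k m x)).comp (onSliceL k m)) x := by
    simpa only [Function.comp_def, onSliceL_apply] using h
  change fderiv ℝ (fun y => f (onSlice y)) x (Pi.single a 1) = _
  rw [h'.fderiv]
  simp [partialDeriv, onSliceL_apply, onSlice_single]

theorem iterPartial_onSlice {f : Model k m → ℝ} (hf : ContDiffAt ℝ ∞ f 0) (K : List (Fin k)) :
    iterPartial K (fun y => f (onSlice y))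
      =ᶠ[𝓝 0] fun x => iterPartial (K.map Sum.inl) f (onSlice x) := by
  induction K with
  | nil => exact Filter.EventuallyEq.rfl
  | cons a K ih =>
    refine (partialDeriv_congr ih a).trans ?_
    filter_upwards [tendsto_onSlice.eventually
      (eventually_differentiableAt (contDiffAt_iterPartial hf (K.map Sum.inl)))] with x hx
    exact partialDeriv_onSlice hx a

theorem iterPartial_onSlice_zero {f : Model k m → ℝ} (hf : ContDiffAt ℝ ∞ f 0)
    (K : List (Fin k)) :
    iterPartial K (fun y => f (onSlice y)) 0 = iterPartial (K.map Sum.inl) f 0 := by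
  rw [(iterPartial_onSlice hf K).eq_of_nhds, onSlice_zero]

theorem contDiffAt_comp_onSlice {f : Model k m → ℝ} (hf : ContDiffAt ℝ ∞ f 0) :
    ContDiffAt ℝ ∞ (fun x : Fin k → ℝ => f (onSlice x)) 0 := by
  rw [← onSlice_zero] at hf
  exact hf.comp 0 contDiff_onSlice.contDiffAt

theorem JetsIn.onSlice {C : Type*} {A : Subalgebra ℝ (C → ℝ)} {N : ℕ}
    {f : C → Model k m → ℝ} (h : JetsIn A N f) :
    JetsIn A N fun c (x : Fin k → ℝ) => f c (onSlice x) :=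
  ⟨fun c => contDiffAt_comp_onSlice (h.smooth c), fun K hK => by
    simpa only [iterPartial_onSlice_zero (h.smooth _)] using h.mem (K.map Sum.inl) (by simpa)⟩

/-- The metric `G` is smooth, symmetric and nondegenerate near the point `x` of the slice, which
is nondegenerate near `x` and orthogonal to the `∂_{α'}`. -/
structure IsOrthogonalAt (G : Model k m → Matrix (Fin k ⊕ Fin m) (Fin k ⊕ Fin m) ℝ)
    (x : Fin k → ℝ) : Prop where
  differentiable : ∀ i j, DifferentiableAt ℝ (fun z => G z i j) (onSlice x)
  symm : ∀ᶠ z in 𝓝 (onSlice x), ∀ i j, G z i j = G z j i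
  det_ne : (G (onSlice x)).det ≠ 0
  det_induced_ne : (inducedMetric G x).det ≠ 0
  orth : ∀ᶠ y in 𝓝 x, ∀ a c, G (onSlice y) (Sum.inl a) (Sum.inr c) = 0

namespace IsOrthogonalAt

variable {G : Model k m → Matrix (Fin k ⊕ Fin m) (Fin k ⊕ Fin m) ℝ} {x : Fin k → ℝ}

/-- Along the slice the metric is block diagonal, so the lowered equation with a tangential index
contains only tangential Christoffel symbols, and its right side involves only derivatives of the
pullback metric. -/
theorem christoffel_induced (h : IsOrthogonalAt G x) (c a b : Fin k) :
    christoffel (inducedMetric G) x c a b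
      = christoffel G (onSlice x) (Sum.inl c) (Sum.inl a) (Sum.inl b) := by
  have hd : ∀ a b c : Fin k, partialDeriv a (fun y => inducedMetric G y b c) x
      = partialDeriv (Sum.inl a) (fun z => G z (Sum.inl b) (Sum.inl c)) (onSlice x) :=
    fun a b c => partialDeriv_onSlice (h.differentiable _ _) a
  refine congrFun (eq_of_forall_sum_eq h.det_induced_ne
    (v := fun c => christoffel (inducedMetric G) x c a b)
    (w := fun c => christoffel G (onSlice x) (Sum.inl c) (Sum.inl a) (Sum.inl b))
    fun q => ?_) c
  have h' := sum_mul_christoffel h.det_ne (Sum.inl q) (Sum.inl a) (Sum.inl b)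
  rw [Fintype.sum_sum_type] at h'
  simp only [h.orth.self_of_nhds, zero_mul, Finset.sum_const_zero, add_zero] at h'
  rw [sum_mul_christoffel h.det_induced_ne, hd, hd, hd, ← h']
  rfl

/-- Orthogonality gives `n_{β'} = ∂_{β'}` at the point, and the normal components of `n_{β'}` are
constant in any case, so the derivative term vanishes. -/
theorem normalConnection_eq (h : IsOrthogonalAt G x) (a : Fin k) (b c : Fin m) :
    normalConnection G x a b c
      = christoffel G (onSlice x) (Sum.inr c) (Sum.inl a) (Sum.inr b) := by
  have hn : normalFrame G b x = Pi.single (Sum.inr b) 1 := by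
    funext i
    cases i with
    | inl i => simp [normalFrame, normalProj, Pi.single_apply, h.orth.self_of_nhds]
    | inr i => simp [normalFrame, normalProj, Pi.single_apply]
  have hc : (fun y => normalFrame G b y (Sum.inr c))
      = fun _ => (Pi.single (Sum.inr b) 1 : Model k m) (Sum.inr c) := rfl
  simp only [normalConnection, normalProj, Sum.elim_inr, hn, hc, partialDeriv_const]
  simp [Pi.single_apply]

/-- The Weingarten equation: differentiating `g(∂_c, ∂_{b'}) = 0` along the slice gives `g(∇_a
∂_{b'}, ∂_c) = -g(∂_{b'}, ∇_a ∂_c)`, so these symbols are determined by the second fundamental form.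
-/
theorem christoffel_mixed (h : IsOrthogonalAt G x) (q a : Fin k) (b : Fin m) :
    christoffel G (onSlice x) (Sum.inl q) (Sum.inl a) (Sum.inr b)
      = ∑ c, (inducedMetric G x)⁻¹ q c * -∑ d, G (onSlice x) (Sum.inr b) (Sum.inr d) *
          christoffel G (onSlice x) (Sum.inr d) (Sum.inl c) (Sum.inl a) := by
  refine eq_sum_inv_mul h.det_induced_ne
    (v := fun q => christoffel G (onSlice x) (Sum.inl q) (Sum.inl a) (Sum.inr b))
    (w := fun c => -∑ d, G (onSlice x) (Sum.inr b) (Sum.inr d) *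
          christoffel G (onSlice x) (Sum.inr d) (Sum.inl c) (Sum.inl a)) (fun c => ?_) q
  have hs : ∀ s i j, partialDeriv s (fun y => G y i j) (onSlice x)
      = partialDeriv s (fun y => G y j i) (onSlice x) :=
    fun s i j => (partialDeriv_congr (h.symm.mono fun y hy => hy i j) s).eq_of_nhds
  have ho : ∀ a c b, partialDeriv (Sum.inl a) (fun z => G z (Sum.inl c) (Sum.inr b)) (onSlice x)
      = 0 := fun a c b => by
    rw [← partialDeriv_onSlice (h.differentiable _ _) a,
      (partialDeriv_congr (h.orth.mono fun y hy => hy c b) a).eq_of_nhds, partialDeriv_const]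
  have h₁ := sum_mul_christoffel h.det_ne (Sum.inl c) (Sum.inl a) (Sum.inr b)
  have h₂ := sum_mul_christoffel h.det_ne (Sum.inr b) (Sum.inl c) (Sum.inl a)
  rw [Fintype.sum_sum_type] at h₁ h₂
  have hG : ∀ b a, G (onSlice x) (Sum.inr b) (Sum.inl a) = 0 := fun b a => by
    rw [h.symm.self_of_nhds]
    exact h.orth.self_of_nhds a b
  simp only [h.orth.self_of_nhds, hG, zero_mul, Finset.sum_const_zero, add_zero, zero_add,
    ho, hs _ (Sum.inr _) (Sum.inl _)] at h₁ h₂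
  rw [h₂]
  refine Eq.trans ?_ (h₁.trans ?_)
  · rfl
  · rw [hs (Sum.inr b) (Sum.inl a) (Sum.inl c)]
    ring

end IsOrthogonalAt

end Slice

end SubmanifoldNormal

namespace SubmanifoldNormal

/-! ### Metrics in submanifold normal coordinates -/

section NormalMetric

variable {k m : ℕ}

/-- The germ at the origin of the metric `G` satisfies the gauge conditions that characterize
submanifold geodesic normal coordinates. -/
structure IsNormalMetric (h₁ : Matrix (Fin k) (Fin k) ℝ) (h₂ : Matrix (Fin m) (Fin m) ℝ)
    (G : Model k m → Matrix (Fin k ⊕ Fin m) (Fin k ⊕ Fin m) ℝ) : Prop where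
  smooth : ∀ i j, ContDiffAt ℝ ∞ (fun z => G z i j) 0
  symm : ∀ᶠ z in 𝓝 0, ∀ i j, G z i j = G z j i
  zero : G 0 = Matrix.fromBlocks h₁ 0 0 h₂
  orth : ∀ᶠ x in 𝓝 0, ∀ a c, G (onSlice x) (Sum.inl a) (Sum.inr c) = 0
  radial : ∀ᶠ x in 𝓝 0, ∀ l,
    ∑ a, x a * ∑ b, x b * christoffel (inducedMetric G) x l a b = 0
  parallel : ∀ᶠ x in 𝓝 0, ∀ b c,
    ∑ a, x a * christoffel G (onSlice x) (Sum.inr c) (Sum.inl a) (Sum.inr b) = 0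
  normal : ∀ᶠ z in 𝓝 0, ∀ i,
    ∑ a, z (Sum.inr a) * ∑ b, z (Sum.inr b) * christoffel G z i (Sum.inr a) (Sum.inr b) = 0

variable {h₁ : Matrix (Fin k) (Fin k) ℝ} {h₂ : Matrix (Fin m) (Fin m) ℝ}
  {G : Model k m → Matrix (Fin k ⊕ Fin m) (Fin k ⊕ Fin m) ℝ}

namespace IsNormalMetric

theorem det_zero (h : IsNormalMetric h₁ h₂ G) : (G 0).det = h₁.det * h₂.det := by
  rw [h.zero, Matrix.det_fromBlocks_zero₂₁]

theorem det_induced_zero (h : IsNormalMetric h₁ h₂ G) : (inducedMetric G 0).det = h₁.det := by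
  have : inducedMetric G 0 = h₁ := by
    ext a b
    simp [inducedMetric, onSlice_zero, h.zero]
  rw [this]

theorem contDiffAt_induced (h : IsNormalMetric h₁ h₂ G) (a b : Fin k) :
    ContDiffAt ℝ ∞ (fun x => inducedMetric G x a b) 0 :=
  contDiffAt_comp_onSlice (h.smooth _ _)

theorem eventually_isOrthogonalAt (h : IsNormalMetric h₁ h₂ G) (hh₁ : h₁.det ≠ 0)
    (hh₂ : h₂.det ≠ 0) : ∀ᶠ x in 𝓝 0, IsOrthogonalAt G x := by
  have hd : ∀ᶠ z in 𝓝 (0 : Model k m), ∀ i j, DifferentiableAt ℝ (fun z => G z i j) z :=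
    Filter.eventually_all.2 fun i => Filter.eventually_all.2 fun j =>
      eventually_differentiableAt (h.smooth i j)
  have hdet : ∀ᶠ z in 𝓝 (0 : Model k m), (G z).det ≠ 0 :=
    (contDiffAt_det h.smooth).continuousAt.eventually_ne (h.det_zero.trans_ne (mul_ne_zero hh₁ hh₂))
  have hdet' : ∀ᶠ x in 𝓝 (0 : Fin k → ℝ), (inducedMetric G x).det ≠ 0 :=
    (contDiffAt_det h.contDiffAt_induced).continuousAt.eventually_ne
      (h.det_induced_zero.trans_ne hh₁)
  filter_upwards [tendsto_onSlice.eventually hd, tendsto_onSlice.eventually h.symm.eventually_nhds,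
    tendsto_onSlice.eventually hdet, hdet', h.orth.eventually_nhds] with x e₁ e₂ e₃ e₄ e₅
  exact ⟨e₁, e₂, e₃, e₄, e₅⟩

end IsNormalMetric

/-- The same recursion as for `∇^r Rm`, with an extra term from the connection of the normal bundle.
-/
theorem partialDeriv_iterCovSecondFF (r : ℕ) (I : Fin (2 + r) → Fin k) (c : Fin m) (a : Fin k)
    (x : Fin k → ℝ) :
    partialDeriv a (fun y => iterCovSecondFF G r y I c) x =
      iterCovSecondFF G (r + 1) x (Fin.snoc (α := fun _ => Fin k) I a) c +
        ∑ s : Fin (2 + r), ∑ l, christoffel (inducedMetric G) x l a (I s) *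
          iterCovSecondFF G r x (Function.update I s l) c -
        ∑ d, normalConnection G x a d c * iterCovSecondFF G r x I d := by
  simp only [iterCovSecondFF, covDerivNormal]
  erw [Fin.snoc_last, Fin.init_snoc]
  have key : ∀ a b c : ℝ, a = a - b + c + b - c := fun a b c => by ring
  exact key _ _ _

/-! ### The algebra of universal curvature polynomials -/

variable (h₁ h₂) in
/-- The metrics in submanifold normal coordinates for the reference form `h₁ ⊕ h₂`. -/
abbrev NormalMetric : Type := {G // IsNormalMetric h₁ h₂ G}

variable (h₁ h₂) in
/-- The functions of the metric that are polynomials in the components at the origin of the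
`∇^r Rm` and the `∇̄^r L`. -/
noncomputable def curvatureAlgebra : Subalgebra ℝ (NormalMetric h₁ h₂ → ℝ) :=
  (MvPolynomial.aeval fun v (c : NormalMetric h₁ h₂) => curvatureValue c.1 v).range

theorem curvatureValue_mem (v : CurvatureVar k m) :
    (fun c => curvatureValue c.1 v) ∈ curvatureAlgebra h₁ h₂ :=
  ⟨MvPolynomial.X v, MvPolynomial.aeval_X _ v⟩

/-- The partial derivatives at the origin of the Christoffel symbols `Γ^i_{lj}`, as a function of
the list of all lower indices. -/
noncomputable def christoffelJet (h₁ : Matrix (Fin k) (Fin k) ℝ) (h₂ : Matrix (Fin m) (Fin m) ℝ)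
    (i : Fin k ⊕ Fin m) : List (Fin k ⊕ Fin m) → NormalMetric h₁ h₂ → ℝ
  | l :: j :: K => fun c => iterPartial K (fun z => christoffel c.1 z i l j) 0
  -- A default value: only lists of length `N + 2` are used.
  | _ => 0

/-- A function of lists which modulo `A` is invariant under permutations of the first three
entries and of the entries after the second is so under all permutations. -/
theorem sub_mem_of_perm {C ι : Type*} {A : Subalgebra ℝ (C → ℝ)} {t : List ι → C → ℝ} {N : ℕ}
    (ht₁ : ∀ l j K, t (l :: j :: K) = t (j :: l :: K))
    (ht₂ : ∀ l j K K', K.Perm K' → t (l :: j :: K) = t (l :: j :: K'))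
    (ht₃ : ∀ l j s K, K.length + 3 = N → t (l :: j :: s :: K) - t (s :: j :: l :: K) ∈ A)
    {J J' : List ι} (h : J.Perm J') (hJ : J.length = N) : t J - t J' ∈ A := by
  suffices H : ∀ pre : List ι, (pre ++ J).length = N → t (pre ++ J) - t (pre ++ J') ∈ A from
    H [] hJ
  clear hJ
  induction h with
  | nil => simp [A.zero_mem]
  | cons x _ ih => exact fun pre hp => by simpa using ih (pre ++ [x]) (by simpa using hp)
  | swap x y K =>
    intro pre hp
    -- The position decides the symmetry: `ht₁` exchanges the first two entries, `ht₃` conjugated by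
    -- `ht₁` the second and third, and `ht₂` any later neighbours.
    rcases pre with _ | ⟨a, _ | ⟨b, pre⟩⟩
    · simp [ht₁ y x K, A.zero_mem]
    · have := ht₃ y a x K (by simpa using hp)
      simpa only [List.cons_append, List.nil_append, ht₁ a] using this
    · simp only [List.cons_append]
      rw [ht₂ a b _ _ ((List.Perm.swap x y K).append_left pre)]
      simp [A.zero_mem]
  | trans h _ ih₁ ih₂ =>
    intro pre hp
    have := A.add_mem (ih₁ pre hp) (ih₂ pre (by simpa [h.length_eq] using hp))
    simpa using this

/-- A list of indices contains no normal index, exactly one, or at least two. -/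
theorem exists_perm_normal (J : List (Fin k ⊕ Fin m)) :
    (∃ J' : List (Fin k), J.Perm (J'.map Sum.inl)) ∨
      (∃ (b : Fin m) (J' : List (Fin k)), J.Perm (Sum.inr b :: J'.map Sum.inl)) ∨
      ∃ a b J', J.Perm (Sum.inr a :: Sum.inr b :: J') := by
  induction J with
  | nil => exact Or.inl ⟨[], by simp⟩
  | cons i J ih =>
    rcases i with i | i <;> rcases ih with ⟨J', h⟩ | ⟨b, J', h⟩ | ⟨a, b, J', h⟩
    · exact Or.inl ⟨i :: J', by simpa using h⟩
    · exact Or.inr (Or.inl ⟨b, i :: J', (h.cons _).trans (List.Perm.swap _ _ _)⟩)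
    · exact Or.inr (Or.inr ⟨a, b, Sum.inl i :: J', (h.cons _).trans
        ((List.Perm.swap _ _ _).trans ((List.Perm.swap _ _ _).cons _))⟩)
    · exact Or.inr (Or.inl ⟨i, J', h.cons _⟩)
    · exact Or.inr (Or.inr ⟨i, b, J'.map Sum.inl, h.cons _⟩)
    · exact Or.inr (Or.inr ⟨i, a, Sum.inr b :: J', h.cons _⟩)

/-! ### The induction step: from the `N`-jet of the metric to the `N`-jet of the Christoffel symbols
-/

section Induction

variable (hh₁ : h₁.det ≠ 0) (hh₂ : h₂.det ≠ 0) {N : ℕ}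
  (hG : ∀ i j, JetsIn (curvatureAlgebra h₁ h₂) N fun c z => c.1 z i j)

include hh₁ hh₂

theorem contDiffAt_christoffel_normal (c : NormalMetric h₁ h₂) (i l j : Fin k ⊕ Fin m) :
    ContDiffAt ℝ ∞ (fun z => christoffel c.1 z i l j) 0 :=
  contDiffAt_christoffel c.2.smooth (c.2.det_zero.trans_ne (mul_ne_zero hh₁ hh₂)) i l j

theorem contDiffAt_normalConnection (c : NormalMetric h₁ h₂) (a : Fin k) (b d : Fin m) :
    ContDiffAt ℝ ∞ (fun x => normalConnection c.1 x a b d) 0 :=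
  (contDiffAt_comp_onSlice (contDiffAt_christoffel_normal hh₁ hh₂ c (Sum.inr d) (Sum.inl a)
    (Sum.inr b))).congr_of_eventuallyEq ((c.2.eventually_isOrthogonalAt hh₁ hh₂).mono
      fun _ hx => hx.normalConnection_eq a b d)

theorem contDiffAt_iterCovSecondFF (c : NormalMetric h₁ h₂) (r : ℕ) (I : Fin (2 + r) → Fin k)
    (d : Fin m) : ContDiffAt ℝ ∞ (fun x => iterCovSecondFF c.1 r x I d) 0 := by
  induction r generalizing d with
  | zero => exact contDiffAt_comp_onSlice (contDiffAt_christoffel_normal hh₁ hh₂ c _ _ _)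
  | succ r ih =>
    exact ((contDiffAt_partialDeriv (ih _ _) _).sub (ContDiffAt.sum fun s _ =>
      ContDiffAt.sum fun l _ => (contDiffAt_christoffel c.2.contDiffAt_induced
        (c.2.det_induced_zero.trans_ne hh₁) _ _ _).mul (ih _ _))).add
      (ContDiffAt.sum fun e _ => (contDiffAt_normalConnection hh₁ hh₂ c _ _ _).mul (ih _ _))

include hG

theorem jetsIn_christoffel_of_lt {d : ℕ} (hd : d + 1 ≤ N) (i l j : Fin k ⊕ Fin m) :
    JetsIn (curvatureAlgebra h₁ h₂) d fun c z => christoffel c.1 z i l j :=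
  JetsIn.christoffel (fun a b => (hG a b).mono hd) (mul_ne_zero hh₁ hh₂)
    (fun c => c.2.det_zero) i l j

/-- The values at the origin are generators of the algebra, and each partial derivative is `∇^{r+1}
Rm` plus terms `Γ · ∇^r Rm`. Hence jets of order `d` use `Γ` only to order `d - 1`. This is what
makes `Rm` known to order `N`, although its definition contains second derivatives of the metric. -/
theorem jetsIn_iterCovRiemann {d r : ℕ} (hN : r + d ≤ N) (I : Fin (4 + r) → Fin k ⊕ Fin m) :
    JetsIn (curvatureAlgebra h₁ h₂) d fun c z => iterCovRiemann c.1 r z I := by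
  have hs : ∀ (r : ℕ) (I : Fin (4 + r) → Fin k ⊕ Fin m) (c : NormalMetric h₁ h₂),
      ContDiffAt ℝ ∞ (fun z => iterCovRiemann c.1 r z I) 0 := fun r I c =>
    contDiffAt_iterCovRiemann c.2.smooth (c.2.det_zero.trans_ne (mul_ne_zero hh₁ hh₂)) r I
  induction d generalizing r with
  | zero => exact JetsIn.zero_iff.2 ⟨hs r I, curvatureValue_mem (.rm r I)⟩
  | succ d ih =>
    refine JetsIn.succ_iff.2 ⟨hs r I, curvatureValue_mem (.rm r I), fun i => ?_⟩
    refine ((ih (r := r + 1) (by omega) (Fin.snoc (α := fun _ => Fin k ⊕ Fin m) I i)).add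
      (JetsIn.sum (s := Finset.univ) fun s _ => JetsIn.sum (s := Finset.univ) fun l _ =>
        (jetsIn_christoffel_of_lt hh₁ hh₂ hG (by omega) l i (I s)).mul
          (ih (r := r) (by omega) (Function.update I s l)))).congr fun c => ?_
    exact Filter.Eventually.of_forall fun z => (partialDeriv_iterCovRiemann r I i).symm

/-- The same exchange of partial for covariant derivatives on the slice. The two connections
involved are the one of the pullback metric and the normal one, whose coefficients are ambient
Christoffel symbols by orthogonality. -/
theorem jetsIn_iterCovSecondFF {d r : ℕ} (hN : r + d ≤ N) (I : Fin (2 + r) → Fin k)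
    (e : Fin m) :
    JetsIn (curvatureAlgebra h₁ h₂) d fun c x => iterCovSecondFF c.1 r x I e := by
  have hs := fun (r : ℕ) (I : Fin (2 + r) → Fin k) (e : Fin m) (c : NormalMetric h₁ h₂) =>
    contDiffAt_iterCovSecondFF hh₁ hh₂ c r I e
  induction d generalizing r e with
  | zero => exact JetsIn.zero_iff.2 ⟨hs r I e, curvatureValue_mem (.sff r I e)⟩
  | succ d ih =>
    refine JetsIn.succ_iff.2 ⟨hs r I e, curvatureValue_mem (.sff r I e), fun a => ?_⟩
    refine (((ih (r := r + 1) (by omega) (Fin.snoc (α := fun _ => Fin k) I a) e).add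
      (JetsIn.sum (s := Finset.univ) fun s _ => JetsIn.sum (s := Finset.univ) fun l _ =>
        (JetsIn.christoffel (fun b c => ((hG _ _).mono (by omega)).onSlice) hh₁
          (fun c => c.2.det_induced_zero) l a (I s)).mul
          (ih (r := r) (by omega) (Function.update I s l) e))).sub
      (JetsIn.sum (s := Finset.univ) fun f _ => JetsIn.mul (JetsIn.congr
        (jetsIn_christoffel_of_lt hh₁ hh₂ hG (by omega) (Sum.inr e) (Sum.inl a)
          (Sum.inr f)).onSlice fun c => (c.2.eventually_isOrthogonalAt hh₁ hh₂).mono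
            fun x hx => (hx.normalConnection_eq a f e).symm)
        (ih (r := r) (by omega) I f))).congr fun c => ?_
    exact Filter.Eventually.of_forall fun x => (partialDeriv_iterCovSecondFF r I e a x).symm

theorem jetsIn_curvature (i j a b : Fin k ⊕ Fin m) :
    JetsIn (curvatureAlgebra h₁ h₂) N fun c z => curvature c.1 z i j a b := by
  refine JetsIn.congr (JetsIn.sum (s := Finset.univ) fun s _ => (JetsIn.matrix_inv hG
    (mul_ne_zero hh₁ hh₂) (fun c => c.2.det_zero) i s).mul
      (jetsIn_iterCovRiemann hh₁ hh₂ hG (r := 0) (by omega) ![s, j, a, b])) fun c => ?_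
  filter_upwards [(contDiffAt_det c.2.smooth).continuousAt.eventually_ne
    (c.2.det_zero.trans_ne (mul_ne_zero hh₁ hh₂))] with z hz
  exact (riemann_eq_curvature hz i j a b).symm

/-- Exchange of `l, j` is the symmetry of the connection, and permutation of `K` is the commuting of
derivatives. Exchange of a derivative index with a lower index costs a curvature term and products
of Christoffel symbols, whose relevant jets are already in the algebra. -/
theorem christoffelJet_perm (i : Fin k ⊕ Fin m) {J J' : List (Fin k ⊕ Fin m)} (h : J.Perm J')
    (hJ : J.length = N + 2) :
    christoffelJet h₁ h₂ i J - christoffelJet h₁ h₂ i J' ∈ curvatureAlgebra h₁ h₂ := by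
  have hs := contDiffAt_christoffel_normal (m := m) hh₁ hh₂
  refine sub_mem_of_perm (fun l j K => ?_) (fun l j K K' hK => ?_) (fun l j s K hK => ?_) h hJ
  · funext c
    refine (iterPartial_congr ?_ K).eq_of_nhds
    exact c.2.symm.eventually_nhds.mono fun z hz => christoffel_symm hz i l j
  · funext c
    exact (iterPartial_perm (hs c _ _ _) hK).eq_of_nhds
  -- Here `K` has length `N - 1`, since one of the `N` derivatives is `s`. This leaves the quadratic
  -- terms within the known order.
  · have hd : JetsIn (curvatureAlgebra h₁ h₂) K.length fun c z =>
        partialDeriv s (fun z => christoffel c.1 z i l j) z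
          - partialDeriv l (fun z => christoffel c.1 z i s j) z := by
      have hΓ := fun i l j => jetsIn_christoffel_of_lt hh₁ hh₂ hG (d := K.length) (by omega) i l j
      refine (((jetsIn_curvature hh₁ hh₂ hG i j s l).mono (by omega)).sub
        (JetsIn.sum (s := Finset.univ) fun q _ => ((hΓ i s q).mul (hΓ q l j)).sub
          ((hΓ i l q).mul (hΓ q s j)))).congr fun c => ?_
      exact Filter.Eventually.of_forall fun z => add_sub_cancel_right _ _
    convert hd.mem K le_rfl using 1
    funext c
    have h₁' : iterPartial (s :: K) (fun z => christoffel c.1 z i l j) 0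
        = iterPartial K (partialDeriv s fun z => christoffel c.1 z i l j) 0 := by
      rw [← iterPartial_concat]
      exact (iterPartial_perm (hs c _ _ _) (List.perm_append_comm (l₁ := [s]))).eq_of_nhds
    have h₂' : iterPartial (l :: K) (fun z => christoffel c.1 z i s j) 0
        = iterPartial K (partialDeriv l fun z => christoffel c.1 z i s j) 0 := by
      rw [← iterPartial_concat]
      exact (iterPartial_perm (hs c _ _ _) (List.perm_append_comm (l₁ := [l]))).eq_of_nhds
    -- Subtractivity comes from additivity applied to `(F - H) + H = F`.
    have hsub := fun c : NormalMetric h₁ h₂ => (iterPartial_add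
      (f := fun z => partialDeriv s (fun z => christoffel c.1 z i l j) z
          - partialDeriv l (fun z => christoffel c.1 z i s j) z)
      ((contDiffAt_partialDeriv (hs c i l j) s).sub (contDiffAt_partialDeriv (hs c i s j) l))
      (contDiffAt_partialDeriv (hs c i s j) l) K).eq_of_nhds
    simp only [sub_add_cancel] at hsub
    change iterPartial (s :: K) (fun z => christoffel c.1 z i l j) 0
      - iterPartial (l :: K) (fun z => christoffel c.1 z i s j) 0 = _
    rw [h₁', h₂', sub_eq_iff_eq_add]
    exact hsub c

/-- The jets of the Christoffel symbols with at least two normal lower indices are determined by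
the geodesic equation of the normal geodesics. -/
theorem christoffelJet_mem_of_two_normal (i : Fin k ⊕ Fin m) {J J' : List (Fin k ⊕ Fin m)}
    {a b : Fin m} (hJ : J.length = N + 2) (h : J.Perm (Sum.inr a :: Sum.inr b :: J')) :
    christoffelJet h₁ h₂ i J ∈ curvatureAlgebra h₁ h₂ := by
  have hs := contDiffAt_christoffel_normal (m := m) hh₁ hh₂
  -- The weight `w` is the indicator of the normal indices. It turns the sum over normal indices in
  -- the geodesic equation into a sum over all indices, as `exists_iterPartial_radial` requires.
  let w : Fin k ⊕ Fin m → ℕ := Sum.elim 0 1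
  let f₂ : Fin k ⊕ Fin m → Fin k ⊕ Fin m → NormalMetric h₁ h₂ → Model k m → ℝ :=
    fun p q c z => (w p : ℝ) * w q * christoffel c.1 z i p q
  have hf₂ : ∀ p q c, ContDiffAt ℝ ∞ (f₂ p q c) 0 := fun p q c => contDiffAt_const.mul (hs c _ _ _)
  have hw : 2 ≤ (J.map w).sum := by
    rw [(h.map w).sum_eq]
    simp [w]
    omega
  -- Applied once for each of the two factors `z`. Every choice of two normal entries of `J` to be
  -- absorbed by these factors contributes one copy of the jet modulo the algebra, and every other
  -- choice contributes zero.
  have key := exists_iterPartial_radial (A := curvatureAlgebra h₁ h₂)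
    (v := christoffelJet h₁ h₂ i J) w J (fun p c z => ∑ q, z q * f₂ p q c z)
    (fun p c => ContDiffAt.sum fun q _ => (contDiffAt_coord q).mul (hf₂ p q c)) (by
      intro p K hK
      obtain ⟨n, hn, hmem⟩ := exists_iterPartial_radial (A := curvatureAlgebra h₁ h₂)
        (v := christoffelJet h₁ h₂ i J) (fun q => w p * w q) K (f₂ p) (hf₂ p) (by
          intro q K' hK'
          by_cases hpq : w p * w q = 0
          · refine ⟨0, hpq.le, ?_⟩
            have : ∀ c, f₂ p q c = fun _ => 0 := fun c => by
              funext z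
              simp only [f₂, ← Nat.cast_mul, hpq, Nat.cast_zero, zero_mul]
            simp only [this, iterPartial_zero, Nat.cast_zero, zero_smul, sub_zero]
            exact (curvatureAlgebra h₁ h₂).zero_mem
          · have hpq1 : w p * w q = 1 := by
              rcases p with p | p <;> rcases q with q | q <;> simp_all [w]
            refine ⟨1, hpq1.le, ?_⟩
            have : ∀ c, f₂ p q c = fun z => christoffel c.1 z i p q := fun c => by
              funext z
              simp only [f₂, ← Nat.cast_mul, hpq1, Nat.cast_one, one_mul]
            simp only [this, Nat.cast_one, one_smul]
            exact christoffelJet_perm hh₁ hh₂ hG i ((hK'.cons p).trans hK) (by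
              rw [((hK'.cons p).trans hK).length_eq, hJ]))
      refine ⟨n, ?_, hmem⟩
      -- After one normal index is removed, `K` still contains another, so the inner multiplicity is
      -- at least `1`.
      refine le_trans ?_ hn
      rw [← (hK.map w).sum_eq] at hw
      rcases p with p | p
      · simp [w]
      · have : (fun q => w (Sum.inr p) * w q) = w := by
          funext q
          simp [w]
        rw [this]
        simp [w] at hw ⊢
        omega)
  obtain ⟨n, hn, hmem⟩ := key
  refine mem_of_radial_eq_zero (by omega) hmem fun c => ?_
  have h0 : (fun z => ∑ p, z p * ∑ q, z q * f₂ p q c z) =ᶠ[𝓝 0] fun _ => 0 := by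
    filter_upwards [c.2.normal] with z hz
    rw [← hz i, Fintype.sum_sum_type]
    simp [f₂, w]
  rw [(iterPartial_congr h0 J).eq_of_nhds, iterPartial_zero]

/-- The jets of the Christoffel symbols with one normal lower index are determined by the second
fundamental form and by the normal frame being parallel. -/
theorem christoffelJet_mem_of_one_normal (i : Fin k ⊕ Fin m) {J : List (Fin k ⊕ Fin m)}
    {J' : List (Fin k)} {b : Fin m} (hJ : J.length = N + 2)
    (h : J.Perm (Sum.inr b :: J'.map Sum.inl)) :
    christoffelJet h₁ h₂ i J ∈ curvatureAlgebra h₁ h₂ := by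
  have hs := contDiffAt_christoffel_normal (m := m) hh₁ hh₂
  have hJ' : J'.length = N + 1 := by
    have := h.length_eq
    simp at this
    omega
  have hperm : ∀ a K, (a :: K).Perm J' →
      (fun c => iterPartial K (fun x => christoffel c.1 (onSlice x) i (Sum.inl a) (Sum.inr b)) 0)
        - christoffelJet h₁ h₂ i J ∈ curvatureAlgebra h₁ h₂ := fun a K hK => by
    simp only [iterPartial_onSlice_zero (hs _ i (Sum.inl a) (Sum.inr b))]
    have hp : (Sum.inl a :: Sum.inr b :: K.map Sum.inl).Perm J :=
      (List.Perm.swap _ _ _).trans (((hK.map Sum.inl).cons _).trans h.symm)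
    exact christoffelJet_perm hh₁ hh₂ hG i hp (hp.length_eq.trans hJ)
  rcases i with i | i
  -- Tangential upper index: the Weingarten equation expresses the symbol through `g`, the inverse
  -- of the pullback metric and `L`, all known to order `N`.
  · obtain ⟨a, K, rfl⟩ := List.exists_cons_of_length_eq_add_one hJ'
    have hm : JetsIn (curvatureAlgebra h₁ h₂) N fun c x =>
        christoffel c.1 (onSlice x) (Sum.inl i) (Sum.inl a) (Sum.inr b) := by
      refine JetsIn.congr (JetsIn.sum (s := Finset.univ) fun q _ => (JetsIn.matrix_inv
        (fun a b => (hG _ _).onSlice) hh₁ (fun c => c.2.det_induced_zero) i q).mul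
          (JetsIn.sum (s := Finset.univ) fun d _ => (hG (Sum.inr b) (Sum.inr d)).onSlice.mul
            (jetsIn_iterCovSecondFF hh₁ hh₂ hG (r := 0) (by omega) ![q, a] d)).neg) fun c => ?_
      filter_upwards [c.2.eventually_isOrthogonalAt hh₁ hh₂] with x hx
      exact (hx.christoffel_mixed i a b).symm
    have := (curvatureAlgebra h₁ h₂).sub_mem (hm.mem K (by simpa using hJ'.le))
      (hperm a K (List.Perm.refl _))
    simpa using this
  -- Normal upper index: the equation `x^a Γ^{c'}_{ab'} = 0` of the parallel frame is differentiated
  -- `N + 1` times, one derivative being absorbed by `x^a`.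
  · obtain ⟨n, hn, hmem⟩ := exists_iterPartial_radial (A := curvatureAlgebra h₁ h₂)
      (v := christoffelJet h₁ h₂ (Sum.inr i) J) (fun _ => 1) J'
      (fun a c x => christoffel c.1 (onSlice x) (Sum.inr i) (Sum.inl a) (Sum.inr b))
      (fun a c => contDiffAt_comp_onSlice (hs c _ _ _))
      (fun a K hK => ⟨1, le_rfl, by simpa using hperm a K hK⟩)
    have hn1 : 1 ≤ n := le_trans (by simp [hJ']) hn
    refine mem_of_radial_eq_zero hn1 hmem fun c => ?_
    rw [(iterPartial_congr (g := fun _ => 0) (c.2.parallel.mono fun x hx => hx b i) J').eq_of_nhds,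
      iterPartial_zero]

/-- The jets of the Christoffel symbols with tangential lower indices are determined by the
second fundamental form and by the geodesic equation of the radial geodesics. -/
theorem christoffelJet_mem_of_tangential (i : Fin k ⊕ Fin m) {J : List (Fin k ⊕ Fin m)}
    {J' : List (Fin k)} (hJ : J.length = N + 2) (h : J.Perm (J'.map Sum.inl)) :
    christoffelJet h₁ h₂ i J ∈ curvatureAlgebra h₁ h₂ := by
  have hs := contDiffAt_christoffel_normal (m := m) hh₁ hh₂
  have hJ' : J'.length = N + 2 := by
    have := h.length_eq
    simp at this
    omega
  have hperm : ∀ a b K, (a :: b :: K).Perm J' →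
      (fun c => iterPartial K (fun x => christoffel c.1 (onSlice x) i (Sum.inl a) (Sum.inl b)) 0)
        - christoffelJet h₁ h₂ i J ∈ curvatureAlgebra h₁ h₂ := fun a b K hK => by
    simp only [iterPartial_onSlice_zero (hs _ i (Sum.inl a) (Sum.inl b))]
    have hp : (Sum.inl a :: Sum.inl b :: K.map Sum.inl).Perm J := (hK.map Sum.inl).trans h.symm
    exact christoffelJet_perm hh₁ hh₂ hG i hp (hp.length_eq.trans hJ)
  rcases i with i | i
  -- Tangential upper index: on the slice these are the symbols of the pullback metric, so `x^a x^b
  -- Γ^l_{ab} = 0` applies. Both factors of `x` absorb a derivative.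
  · obtain ⟨n, hn, hmem⟩ := exists_iterPartial_radial (A := curvatureAlgebra h₁ h₂)
      (v := christoffelJet h₁ h₂ (Sum.inl i) J) (fun _ => 1) J'
      (fun a c x => ∑ b, x b * christoffel c.1 (onSlice x) (Sum.inl i) (Sum.inl a) (Sum.inl b))
      (fun a c => ContDiffAt.sum fun b _ =>
        (contDiffAt_coord b).mul (contDiffAt_comp_onSlice (hs c _ _ _)))
      (fun a K hK => by
        obtain ⟨n, hn, hmem⟩ := exists_iterPartial_radial (A := curvatureAlgebra h₁ h₂)
          (v := christoffelJet h₁ h₂ (Sum.inl i) J) (fun _ => 1) K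
          (fun b c x => christoffel c.1 (onSlice x) (Sum.inl i) (Sum.inl a) (Sum.inl b))
          (fun b c => contDiffAt_comp_onSlice (hs c _ _ _))
          (fun b K' hK' => ⟨1, le_rfl, by simpa using hperm a b K' ((hK'.cons a).trans hK)⟩)
        refine ⟨n, le_trans ?_ hn, hmem⟩
        have := hK.length_eq
        simp at this ⊢
        omega)
    have hn1 : 1 ≤ n := le_trans (by simp [hJ']) hn
    refine mem_of_radial_eq_zero hn1 hmem fun c => ?_
    have h0 : (fun x => ∑ a, x a * ∑ b, x b *
        christoffel c.1 (onSlice x) (Sum.inl i) (Sum.inl a) (Sum.inl b)) =ᶠ[𝓝 0] fun _ => 0 := by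
      filter_upwards [c.2.radial, c.2.eventually_isOrthogonalAt hh₁ hh₂] with x hx hx'
      simpa only [hx'.christoffel_induced] using hx i
    rw [(iterPartial_congr h0 J').eq_of_nhds, iterPartial_zero]
  -- Normal upper index: the symbol is by definition a component of `L`, since `normalProj` leaves
  -- the `u`-components unchanged.
  · obtain ⟨a, K, rfl⟩ := List.exists_cons_of_length_eq_add_one hJ'
    obtain ⟨b, K, rfl⟩ := List.exists_cons_of_length_eq_add_one (n := N) (l := K)
      (by simpa using hJ')
    have hL := (jetsIn_iterCovSecondFF hh₁ hh₂ hG (r := 0) (d := N) (by omega) ![a, b] i).mem K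
      (by simpa using hJ'.le)
    have := (curvatureAlgebra h₁ h₂).sub_mem hL (hperm a b K (List.Perm.refl _))
    rwa [show (fun c : NormalMetric h₁ h₂ =>
        iterPartial K (fun x => iterCovSecondFF c.1 0 x ![a, b] i) 0)
      = fun c => iterPartial K (fun x => christoffel c.1 (onSlice x) (Sum.inr i) (Sum.inl a)
        (Sum.inl b)) 0 from rfl, sub_sub_cancel] at this

/-- This gains one order over `jetsIn_christoffel_of_lt`. Only the top order `N` needs the gauge
conditions. -/
theorem jetsIn_christoffel (i l j : Fin k ⊕ Fin m) :
    JetsIn (curvatureAlgebra h₁ h₂) N fun c z => christoffel c.1 z i l j := by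
  refine ⟨fun c => contDiffAt_christoffel_normal hh₁ hh₂ c i l j, fun K hK => ?_⟩
  rcases hK.lt_or_eq with hK | hK
  · exact (jetsIn_christoffel_of_lt hh₁ hh₂ hG hK i l j).mem K le_rfl
  · have hJ : (l :: j :: K).length = N + 2 := by simp [hK]
    rcases exists_perm_normal (l :: j :: K) with ⟨J', h⟩ | ⟨b, J', h⟩ | ⟨a, b, J', h⟩
    · exact christoffelJet_mem_of_tangential hh₁ hh₂ hG i hJ h
    · exact christoffelJet_mem_of_one_normal hh₁ hh₂ hG i hJ h
    · exact christoffelJet_mem_of_two_normal hh₁ hh₂ hG i hJ h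

end Induction

/-- Order zero is the prescribed value `h₁ ⊕ h₂`. Metric compatibility `∂g = gΓ + gΓ` converts the
gained order of `Γ` into the next order of `g`. -/
theorem jetsIn_metric (hh₁ : h₁.det ≠ 0) (hh₂ : h₂.det ≠ 0) (N : ℕ) (i j : Fin k ⊕ Fin m) :
    JetsIn (curvatureAlgebra h₁ h₂) N fun c z => c.1 z i j := by
  induction N generalizing i j with
  | zero =>
    refine JetsIn.zero_iff.2 ⟨fun c => c.2.smooth i j, ?_⟩
    simp only [fun c : NormalMetric h₁ h₂ => c.2.zero]
    exact (curvatureAlgebra h₁ h₂).algebraMap_mem (Matrix.fromBlocks h₁ 0 0 h₂ i j)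
  | succ N ih =>
    refine JetsIn.succ_iff.2 ⟨fun c => c.2.smooth i j, (ih i j).mem [] (Nat.zero_le _),
      fun s => ?_⟩
    have hΓ := jetsIn_christoffel hh₁ hh₂ ih
    refine JetsIn.congr (JetsIn.sum (s := Finset.univ) fun l _ => ((ih i l).mul (hΓ l s j)).add
      ((ih j l).mul (hΓ l s i))) fun c => ?_
    filter_upwards [c.2.symm.eventually_nhds,
      (contDiffAt_det c.2.smooth).continuousAt.eventually_ne
        (c.2.det_zero.trans_ne (mul_ne_zero hh₁ hh₂))] with z hz hz'
    exact (partialDeriv_metric hz hz' s i j).symm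

/-- The Taylor coefficients of a metric in submanifold normal coordinates are universal
polynomials in the covariant derivatives of the curvature and of the second fundamental form. -/
theorem exists_polynomial_iterPartial (hh₁ : h₁.det ≠ 0) (hh₂ : h₂.det ≠ 0)
    (i j : Fin k ⊕ Fin m) (K : List (Fin k ⊕ Fin m)) :
    ∃ P : MvPolynomial (CurvatureVar k m) ℝ, ∀ G, IsNormalMetric h₁ h₂ G →
      iterPartial K (fun z => G z i j) 0 = MvPolynomial.eval (curvatureValue G) P := by
  obtain ⟨P, hP⟩ := (jetsIn_metric hh₁ hh₂ K.length i j).mem K le_rfl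
  refine ⟨P, fun G hG => ?_⟩
  rw [← congrFun hP ⟨G, hG⟩]
  -- Evaluation at one metric is an algebra homomorphism, so the identity of functions in the
  -- algebra specializes to the numerical identity with the same `P`.
  have : ((Pi.evalAlgHom ℝ (fun _ : NormalMetric h₁ h₂ => ℝ) ⟨G, hG⟩).comp
      (MvPolynomial.aeval fun v (c : NormalMetric h₁ h₂) => curvatureValue c.1 v))
      = MvPolynomial.aeval (curvatureValue G) := by
    ext v
    simp
  exact (DFunLike.congr_fun this P).trans (by rw [MvPolynomial.aeval_eq_eval])

end NormalMetric

end SubmanifoldNormal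

namespace SubmanifoldNormal

/-! ### Geodesics in coordinates -/

section CoordinateGeodesics

variable {ι : Type} [Fintype ι] [DecidableEq ι]

theorem contDiffAt_deriv {c : ℝ → ι → ℝ} {t : ℝ} (h : ContDiffAt ℝ ∞ c t) :
    ContDiffAt ℝ ∞ (deriv c) t :=
  (h.fderiv_right (m := ∞) (by simp)).clm_apply contDiffAt_const

theorem eventually_hasDerivAt {c : ℝ → ι → ℝ} {t : ℝ} (h : ContDiffAt ℝ ∞ c t) :
    ∀ᶠ s in 𝓝 t, HasDerivAt c (deriv c s) s := by
  filter_upwards [(h.of_le (m := 1) (by exact_mod_cast le_top)).eventually (by decide)] with s hs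
  exact (hs.differentiableAt (by decide)).hasDerivAt

/-- The vector field on the tangent bundle whose integral curves are the geodesics. -/
noncomputable def geodesicField (H : (ι → ℝ) → Matrix ι ι ℝ) (p : (ι → ℝ) × (ι → ℝ)) :
    (ι → ℝ) × (ι → ℝ) :=
  (p.2, fun i => -∑ j, ∑ l, christoffel H p.1 i j l * p.2 j * p.2 l)

theorem contDiffAt_geodesicField {H : (ι → ℝ) → Matrix ι ι ℝ} {p : (ι → ℝ) × (ι → ℝ)}
    (hH : ∀ a b, ContDiffAt ℝ ∞ (fun z => H z a b) p.1) (hdet : (H p.1).det ≠ 0) :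
    ContDiffAt ℝ ∞ (geodesicField H) p := by
  refine contDiffAt_snd.prodMk (contDiffAt_pi.2 fun i => ContDiffAt.neg
    (ContDiffAt.sum fun j _ => ContDiffAt.sum fun l _ => ((ContDiffAt.mul ?_ ?_).mul ?_)))
  · exact (contDiffAt_christoffel hH hdet i j l).comp p contDiffAt_fst
  · exact (contDiffAt_coord (x := p.2) j).comp p contDiffAt_snd
  · exact (contDiffAt_coord (x := p.2) l).comp p contDiffAt_snd

theorem hasDerivAt_geodesicField {H : (ι → ℝ) → Matrix ι ι ℝ} {c : ℝ → ι → ℝ} {t : ℝ}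
    (h₁ : HasDerivAt c (deriv c t) t) (h₂ : HasDerivAt (deriv c) (deriv (deriv c) t) t)
    (h : covDerivAlong H c (deriv c) t = 0) :
    HasDerivAt (fun s => (c s, deriv c s)) (geodesicField H (c t, deriv c t)) t := by
  have hd : deriv (deriv c) t = (geodesicField H (c t, deriv c t)).2 := by
    funext i
    have hi := congrFun h i
    have e₁ : deriv (fun s => deriv c s i) t = deriv (deriv c) t i :=
      ((hasDerivAt_pi.1 h₂) i).deriv
    have e₂ : ∀ j, deriv (fun s => c s j) t = deriv c t j :=
      fun j => ((hasDerivAt_pi.1 h₁) j).deriv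
    simp only [covDerivAlong, e₁, e₂, Pi.zero_apply] at hi
    simp only [geodesicField]
    linarith
  rw [hd] at h₂
  exact h₁.prodMk h₂

/-- Geodesics with the same initial point and velocity agree near the initial time. -/
theorem eventuallyEq_of_geodesic {H : (ι → ℝ) → Matrix ι ι ℝ} {c₁ c₂ : ℝ → ι → ℝ} {t : ℝ}
    (hH : ∀ a b, ContDiffAt ℝ ∞ (fun z => H z a b) (c₁ t)) (hdet : (H (c₁ t)).det ≠ 0)
    (hc₁ : ContDiffAt ℝ ∞ c₁ t) (hc₂ : ContDiffAt ℝ ∞ c₂ t)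
    (h₁ : ∀ᶠ s in 𝓝 t, covDerivAlong H c₁ (deriv c₁) s = 0)
    (h₂ : ∀ᶠ s in 𝓝 t, covDerivAlong H c₂ (deriv c₂) s = 0)
    (h0 : c₁ t = c₂ t) (h0' : deriv c₁ t = deriv c₂ t) : c₁ =ᶠ[𝓝 t] c₂ := by
  obtain ⟨K, s, hs, hLip⟩ := ((contDiffAt_geodesicField (p := (c₁ t, deriv c₁ t)) hH hdet).of_le
    (m := 1) (by exact_mod_cast le_top)).exists_lipschitzOnWith
  have aux : ∀ {c : ℝ → ι → ℝ}, ContDiffAt ℝ ∞ c t →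
      (∀ᶠ s in 𝓝 t, covDerivAlong H c (deriv c) s = 0) →
      (c t, deriv c t) = (c₁ t, deriv c₁ t) →
      ∀ᶠ r in 𝓝 t, HasDerivAt (fun s => (c s, deriv c s)) (geodesicField H (c r, deriv c r)) r ∧
        (c r, deriv c r) ∈ s := by
    intro c hc h hp
    have hcont : ContinuousAt (fun s => (c s, deriv c s)) t :=
      hc.continuousAt.prodMk (contDiffAt_deriv hc).continuousAt
    have hs' : s ∈ 𝓝 (c t, deriv c t) := by rwa [hp]
    filter_upwards [eventually_hasDerivAt hc, eventually_hasDerivAt (contDiffAt_deriv hc), h,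
      hcont.eventually hs'] with r e₁ e₂ e₃ e₄
    exact ⟨hasDerivAt_geodesicField e₁ e₂ e₃, e₄⟩
  have := ODE_solution_unique_of_eventually (v := fun _ => geodesicField H) (s := fun _ => s)
    (Filter.Eventually.of_forall fun _ => hLip) (aux hc₁ h₁ rfl) (aux hc₂ h₂ (by rw [h0, h0']))
    (by simp only [h0, h0'])
  exact this.mono fun r hr => (Prod.ext_iff.1 hr).1

/-- Both terms of the geodesic equation are homogeneous of degree two in the speed. -/
theorem covDerivAlong_comp_mul {H : (ι → ℝ) → Matrix ι ι ℝ} (c : ℝ → ι → ℝ) (s t : ℝ)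
    (h : covDerivAlong H c (deriv c) (s * t) = 0) :
    covDerivAlong H (fun t => c (s * t)) (deriv fun t => c (s * t)) t = 0 := by
  funext i
  have hi := congrFun h i
  have e₁ : (deriv fun t => c (s * t)) = fun t => s • deriv c (s * t) :=
    funext fun t => deriv_comp_mul_left s c t
  have e₂ : deriv (fun r => s * deriv c (s * r) i) t
      = s * (s * deriv (fun r => deriv c r i) (s * t)) := by
    rw [deriv_const_mul_field]
    exact congrArg _ (deriv_comp_mul_left s (fun r => deriv c r i) t)
  have e₃ : ∀ j, deriv (fun r => c (s * r) j) t = s * deriv (fun r => c r j) (s * t) :=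
    fun j => deriv_comp_mul_left s (fun r => c r j) t
  simp only [covDerivAlong, e₁, Pi.smul_apply, smul_eq_mul, e₂, e₃, Pi.zero_apply] at hi ⊢
  have e₄ : ∑ j, ∑ l, christoffel H (c (s * t)) i j l *
        (s * deriv (fun r => c r j) (s * t)) * (s * deriv c (s * t) l)
      = s * (s * ∑ j, ∑ l, christoffel H (c (s * t)) i j l *
        deriv (fun r => c r j) (s * t) * deriv c (s * t) l) := by
    simp only [Finset.mul_sum]
    exact Finset.sum_congr rfl fun j _ => Finset.sum_congr rfl fun l _ => by ring
  rw [e₄, ← mul_add, ← mul_add, hi, mul_zero, mul_zero]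

/-- The geodesic equation for a curve that is affine near `t`. -/
theorem sum_christoffel_of_affine {H : (ι → ℝ) → Matrix ι ι ℝ} {c : ℝ → ι → ℝ} {t : ℝ}
    {z w : ι → ℝ} (hc : c =ᶠ[𝓝 t] fun s => z + s • w)
    (h : covDerivAlong H c (deriv c) t = 0) (i : ι) :
    ∑ j, ∑ l, christoffel H (z + t • w) i j l * w j * w l = 0 := by
  have hd : ∀ s, HasDerivAt (fun s : ℝ => z + s • w) w s := fun s => by
    simpa using ((hasDerivAt_id s).smul_const w).const_add z
  have e₁ : deriv c =ᶠ[𝓝 t] fun _ => w :=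
    hc.deriv.trans (Filter.Eventually.of_forall fun s => (hd s).deriv)
  have e₂ : deriv (fun s => deriv c s i) t = 0 := by
    have : (fun s => deriv c s i) =ᶠ[𝓝 t] fun _ => w i := e₁.mono fun s hs => congrFun hs i
    rw [this.deriv_eq, deriv_const]
  have e₃ : ∀ j, deriv (fun s => c s j) t = w j := fun j => by
    have : (fun s => c s j) =ᶠ[𝓝 t] fun s => (z + s • w) j := hc.mono fun s hs => congrFun hs j
    rw [this.deriv_eq, ((hasDerivAt_pi.1 (hd t)) j).deriv]
  have hi := congrFun h i
  simpa only [covDerivAlong, e₂, e₃, e₁.self_of_nhds, hc.self_of_nhds, zero_add,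
    Pi.zero_apply] using hi

/-- The curve is known only on `[0, 1]`, of which `0` is an endpoint. The one-sided derivative
determines the full one because the latter is assumed to exist. -/
theorem deriv_eq_of_affine {c : ℝ → ι → ℝ} {z w : ι → ℝ} (hd : DifferentiableAt ℝ c 0)
    (hc : ∀ s ∈ Set.Icc (0 : ℝ) 1, c s = z + s • w) : deriv c 0 = w := by
  have h : HasDerivAt (fun s : ℝ => z + s • w) w 0 := by
    simpa using ((hasDerivAt_id (0 : ℝ)).smul_const w).const_add z
  have h' : HasDerivWithinAt c w (Set.Icc 0 1) 0 :=
    h.hasDerivWithinAt.congr hc (hc 0 (by simp))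
  exact (uniqueDiffOn_Icc (zero_lt_one' ℝ) 0 (by simp)).eq_deriv _ hd.hasDerivAt.hasDerivWithinAt h'

end CoordinateGeodesics

/-! ### Charts -/

section Charts

variable {ι : Type} [Fintype ι] {M : Type*} [TopologicalSpace M]
  [ChartedSpace (ι → ℝ) M] {ψ : OpenPartialHomeomorph M (ι → ℝ)}

theorem mdifferentiable_of_mem_smoothCharts [IsManifold 𝓘(ℝ, ι → ℝ) ∞ M]
    (hψ : ψ ∈ smoothCharts ι M) : ψ.MDifferentiable 𝓘(ℝ, ι → ℝ) 𝓘(ℝ, ι → ℝ) :=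
  ⟨(contMDiffOn_of_mem_maximalAtlas hψ).mdifferentiableOn (by decide),
    (contMDiffOn_symm_of_mem_maximalAtlas hψ).mdifferentiableOn (by decide)⟩

/-- The tangent vector at `ψ⁻¹(z)` with components `w` in the chart `ψ`. -/
noncomputable def vectorOf (ψ : OpenPartialHomeomorph M (ι → ℝ)) (z w : ι → ℝ) :
    TangentSpace 𝓘(ℝ, ι → ℝ) (ψ.symm z) :=
  mfderiv 𝓘(ℝ, ι → ℝ) 𝓘(ℝ, ι → ℝ) ψ.symm z w

variable [IsManifold 𝓘(ℝ, ι → ℝ) ∞ M]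

theorem vectorComp_vectorOf (hψ : ψ ∈ smoothCharts ι M) {z : ι → ℝ} (hz : z ∈ ψ.target)
    (w : ι → ℝ) : vectorComp ψ (ψ.symm z) (vectorOf ψ z w) = w :=
  DFunLike.congr_fun ((mdifferentiable_of_mem_smoothCharts hψ).comp_symm_deriv hz) w

theorem vectorOf_vectorComp (hψ : ψ ∈ smoothCharts ι M) {z : ι → ℝ} (hz : z ∈ ψ.target)
    (v : TangentSpace 𝓘(ℝ, ι → ℝ) (ψ.symm z)) : vectorOf ψ z (vectorComp ψ (ψ.symm z) v) = v := by
  obtain ⟨w, rfl⟩ : ∃ w : ι → ℝ, vectorOf ψ z w = v :=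
    (mdifferentiable_of_mem_smoothCharts hψ).symm.mfderiv_surjective hz v
  rw [vectorComp_vectorOf hψ hz]

theorem contDiffAt_comp_chart (hψ : ψ ∈ smoothCharts ι M) {γ : ℝ → M} {t : ℝ}
    (hγ : ContMDiffAt 𝓘(ℝ, ℝ) 𝓘(ℝ, ι → ℝ) ∞ γ t) (ht : γ t ∈ ψ.source) :
    ContDiffAt ℝ ∞ (fun s => ψ (γ s)) t :=
  contMDiffAt_iff_contDiffAt.1 (((contMDiffOn_of_mem_maximalAtlas hψ).contMDiffAt
    (ψ.open_source.mem_nhds ht)).comp t hγ)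

theorem deriv_comp_chart (hψ : ψ ∈ smoothCharts ι M) {γ : ℝ → M} {t : ℝ}
    (hγ : MDifferentiableAt 𝓘(ℝ, ℝ) 𝓘(ℝ, ι → ℝ) γ t) (ht : γ t ∈ ψ.source) :
    deriv (fun s => ψ (γ s)) t
      = vectorComp ψ (γ t) (mfderiv 𝓘(ℝ, ℝ) 𝓘(ℝ, ι → ℝ) γ t (1 : ℝ)) := by
  have h := mfderiv_comp t ((mdifferentiable_of_mem_smoothCharts hψ).mdifferentiableAt ht) hγ
  rw [mfderiv_eq_fderiv] at h
  exact DFunLike.congr_fun h (1 : ℝ)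

theorem deriv_comp_chart_of_tangentMap {γ : ℝ → M} {q : M} {v : TangentSpace 𝓘(ℝ, ι → ℝ) q}
    (hγ : MDifferentiableAt 𝓘(ℝ, ℝ) 𝓘(ℝ, ι → ℝ) γ 0)
    (h : tangentMap 𝓘(ℝ, ℝ) 𝓘(ℝ, ι → ℝ) γ ⟨(0 : ℝ), (1 : ℝ)⟩ = ⟨q, v⟩) :
    γ 0 = q ∧ ∀ ψ ∈ smoothCharts ι M, q ∈ ψ.source →
      deriv (fun s => ψ (γ s)) 0 = vectorComp ψ q v := by
  have h₀ : γ 0 = q := congrArg Bundle.TotalSpace.proj h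
  subst h₀
  refine ⟨rfl, fun ψ hψ hq => ?_⟩
  rw [deriv_comp_chart hψ hγ hq]
  have h₁ : (mfderiv 𝓘(ℝ, ℝ) 𝓘(ℝ, ι → ℝ) γ 0 (1 : ℝ) : ι → ℝ) = v :=
    congrArg (fun X : TangentBundle 𝓘(ℝ, ι → ℝ) M => (X.2 : ι → ℝ)) h
  exact congrArg (vectorComp ψ (γ 0)) h₁

/-- Two smooth curves in a Hausdorff manifold with the same initial point and velocity agree if
they agree near each time at which their points and velocities do. -/
theorem eqOn_of_local_uniqueness [DecidableEq ι] [T2Space M] {γ₁ γ₂ : ℝ → M}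
    (h₁ : ∀ t ∈ Set.Icc (0 : ℝ) 1, ContMDiffAt 𝓘(ℝ, ℝ) 𝓘(ℝ, ι → ℝ) ∞ γ₁ t)
    (h₂ : ∀ t ∈ Set.Icc (0 : ℝ) 1, ContMDiffAt 𝓘(ℝ, ℝ) 𝓘(ℝ, ι → ℝ) ∞ γ₂ t)
    (hloc : ∀ t ∈ Set.Icc (0 : ℝ) 1, γ₁ t = γ₂ t → (∀ ψ ∈ smoothCharts ι M, γ₁ t ∈ ψ.source →
      deriv (fun s => ψ (γ₁ s)) t = deriv (fun s => ψ (γ₂ s)) t) → γ₁ =ᶠ[𝓝 t] γ₂)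
    (h0 : γ₁ 0 = γ₂ 0) (h0' : ∀ ψ ∈ smoothCharts ι M, γ₁ 0 ∈ ψ.source →
      deriv (fun s => ψ (γ₁ s)) 0 = deriv (fun s => ψ (γ₂ s)) 0) :
    ∀ t ∈ Set.Icc (0 : ℝ) 1, γ₁ t = γ₂ t := by
  -- Connectedness of `[0, 1]`: the set of times near which the curves agree is open. At a limit
  -- time the points agree because `M` is Hausdorff and the velocities by continuity, so `hloc`
  -- applies again.
  have hsub : Set.Icc (0 : ℝ) 1 ⊆ {t | γ₁ =ᶠ[𝓝 t] γ₂} := by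
    refine isPreconnected_Icc.subset_of_closure_inter_subset isOpen_setOfPred_eventually_nhds
      ⟨0, by simp, hloc 0 (by simp) h0 h0'⟩ ?_
    rintro t ⟨htc, ht⟩
    have hfreq := mem_closure_iff_frequently.1 htc
    have heq : γ₁ t = γ₂ t := by
      by_contra hne
      refine hfreq (((h₁ t ht).continuousAt.ne_iff_eventually_ne (h₂ t ht).continuousAt).1 hne
        |>.mono fun s hs hs' => hs ?_)
      exact Filter.EventuallyEq.eq_of_nhds hs'
    refine hloc t ht heq fun ψ hψ hsrc => ?_
    by_contra hne
    have c₁ := (contDiffAt_deriv (contDiffAt_comp_chart hψ (h₁ t ht) hsrc)).continuousAt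
    have c₂ := (contDiffAt_deriv (contDiffAt_comp_chart hψ (h₂ t ht) (heq ▸ hsrc))).continuousAt
    refine hfreq ((c₁.ne_iff_eventually_ne c₂).1 hne |>.mono fun s hs hs' => hs ?_)
    exact Filter.EventuallyEq.deriv_eq (Filter.Eventually.mono hs' fun r hr => congrArg ψ hr)
  exact fun t ht => Filter.EventuallyEq.eq_of_nhds (hsub ht)

end Charts

/-! ### The components of a metric -/

section Metric

variable {ι : Type} [Fintype ι] [DecidableEq ι] {M : Type*} [TopologicalSpace M]
  [ChartedSpace (ι → ℝ) M] {ψ : OpenPartialHomeomorph M (ι → ℝ)}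
  (g : PseudoRiemannianMetric ι M)

theorem PseudoRiemannianMetric.contDiffAt_comp (hψ : ψ ∈ smoothCharts ι M) {z : ι → ℝ}
    (hz : z ∈ ψ.target) (i j : ι) : ContDiffAt ℝ ∞ (fun z => g.comp ψ z i j) z :=
  (g.smooth ψ hψ i j).contDiffAt (ψ.open_target.mem_nhds hz)

theorem PseudoRiemannianMetric.form_vectorOf (z v w : ι → ℝ) :
    g.form (ψ.symm z) (vectorOf ψ z v) (vectorOf ψ z w)
      = ∑ i, v i * ∑ j, w j * g.comp ψ z i j := by
  have hv : ∀ v : ι → ℝ, vectorOf ψ z v = ∑ i, v i • coordVector ψ z i := fun v => by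
    have h := map_sum (mfderiv 𝓘(ℝ, ι → ℝ) 𝓘(ℝ, ι → ℝ) ψ.symm z)
      (fun i => v i • (Pi.single i (1 : ℝ) : ι → ℝ)) Finset.univ
    rw [← pi_eq_sum_univ' v] at h
    refine Eq.trans h (Finset.sum_congr rfl fun i _ => ?_)
    exact map_smul (mfderiv 𝓘(ℝ, ι → ℝ) 𝓘(ℝ, ι → ℝ) ψ.symm z) (v i) (Pi.single i (1 : ℝ) : ι → ℝ)
  rw [hv v, hv w]
  simp only [map_sum, map_smul, LinearMap.sum_apply, LinearMap.smul_apply, smul_eq_mul,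
    Finset.mul_sum]
  rw [Finset.sum_comm]
  refine Finset.sum_congr rfl fun i _ => Finset.sum_congr rfl fun j _ => ?_
  exact mul_left_comm _ _ _

variable [IsManifold 𝓘(ℝ, ι → ℝ) ∞ M]

theorem PseudoRiemannianMetric.form_eq (hψ : ψ ∈ smoothCharts ι M) {z : ι → ℝ}
    (hz : z ∈ ψ.target) (v w : TangentSpace 𝓘(ℝ, ι → ℝ) (ψ.symm z)) :
    g.form (ψ.symm z) v w = ∑ i, vectorComp ψ (ψ.symm z) v i *
      ∑ j, vectorComp ψ (ψ.symm z) w j * g.comp ψ z i j := by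
  rw [← g.form_vectorOf, vectorOf_vectorComp hψ hz, vectorOf_vectorComp hψ hz]

theorem PseudoRiemannianMetric.det_comp_ne_zero (hψ : ψ ∈ smoothCharts ι M) {z : ι → ℝ}
    (hz : z ∈ ψ.target) : (g.comp ψ z).det ≠ 0 := by
  intro h
  obtain ⟨v, hv, hv'⟩ := Matrix.exists_vecMul_eq_zero_iff.2 h
  have h0 : vectorOf ψ z v = 0 := g.nondegenerate _ _ fun w => by
    rw [← vectorOf_vectorComp hψ hz w, g.form_vectorOf]
    simp only [Finset.mul_sum]
    rw [Finset.sum_comm]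
    refine Finset.sum_eq_zero fun j _ => ?_
    have hj : ∑ i, v i * g.comp ψ z i j = 0 := congrFun hv' j
    rw [← mul_zero (vectorComp ψ (ψ.symm z) w j), ← hj, Finset.mul_sum]
    exact Finset.sum_congr rfl fun i _ => by ring
  refine hv ?_
  rw [← vectorComp_vectorOf hψ hz v, h0]
  exact map_zero (mfderiv 𝓘(ℝ, ι → ℝ) 𝓘(ℝ, ι → ℝ) ψ (ψ.symm z))

end Metric

end SubmanifoldNormal

namespace SubmanifoldNormal

/-! ### Geodesics and exponential maps on the manifold -/

section Rays

variable {ι : Type} [Fintype ι] [DecidableEq ι] {M : Type*} [TopologicalSpace M]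
  [ChartedSpace (ι → ℝ) M]

theorem vectorComp_smul (ψ : OpenPartialHomeomorph M (ι → ℝ)) (q : M) (s : ℝ)
    (v : TangentSpace 𝓘(ℝ, ι → ℝ) q) : vectorComp ψ q (s • v) = s • vectorComp ψ q v :=
  map_smul (mfderiv 𝓘(ℝ, ι → ℝ) 𝓘(ℝ, ι → ℝ) ψ q) s v

variable [IsManifold 𝓘(ℝ, ι → ℝ) ∞ M] [T2Space M]

/-- For a class `IsG` of curves which is closed under rescaling of time and in which curves are
determined by their initial point and velocity, the curve with initial velocity `v` passes at time
`s` through the point that the curve with initial velocity `s • v` reaches at time `1`. -/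
theorem exists_ray {IsG : (ℝ → M) → Set ℝ → Prop}
    (hsm : ∀ γ J, IsG γ J → ContMDiffOn 𝓘(ℝ, ℝ) 𝓘(ℝ, ι → ℝ) ∞ γ J)
    (hscale : ∀ γ J (s : ℝ), IsG γ J → IsG (fun t => γ (s * t)) ((fun t => s * t) ⁻¹' J))
    (hloc : ∀ γ₁ γ₂ J₁ J₂ t, IsOpen J₁ → IsOpen J₂ → t ∈ J₁ → t ∈ J₂ → IsG γ₁ J₁ → IsG γ₂ J₂ →
      γ₁ t = γ₂ t → (∀ ψ ∈ smoothCharts ι M, γ₁ t ∈ ψ.source →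
        deriv (fun s => ψ (γ₁ s)) t = deriv (fun s => ψ (γ₂ s)) t) → γ₁ =ᶠ[𝓝 t] γ₂)
    {q : M} {v : TangentSpace 𝓘(ℝ, ι → ℝ) q} {Φ : ℝ → M}
    (h : ∀ s ∈ Set.Icc (0 : ℝ) 1, ∃ (γ : ℝ → M) (J : Set ℝ), IsOpen J ∧ Set.Icc 0 1 ⊆ J ∧
      IsG γ J ∧ tangentMap 𝓘(ℝ, ℝ) 𝓘(ℝ, ι → ℝ) γ ⟨(0 : ℝ), (1 : ℝ)⟩ = ⟨q, s • v⟩ ∧ γ 1 = Φ s) :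
    ∃ (γ : ℝ → M) (J : Set ℝ), IsOpen J ∧ Set.Icc 0 1 ⊆ J ∧ IsG γ J ∧
      (∀ ψ ∈ smoothCharts ι M, q ∈ ψ.source →
        deriv (fun s => ψ (γ s)) 0 = vectorComp ψ q v) ∧
      ∀ s ∈ Set.Icc (0 : ℝ) 1, γ s = Φ s := by
  have hat : ∀ {γ J t}, IsG γ J → IsOpen J → t ∈ J →
      ContMDiffAt 𝓘(ℝ, ℝ) 𝓘(ℝ, ι → ℝ) ∞ γ t := fun hG hJ ht =>
    (hsm _ _ hG).contMDiffAt (hJ.mem_nhds ht)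
  -- The curve for `s = 1` serves as the ray. Its rescaling by `s` has initial velocity `s • v`,
  -- hence coincides on `[0, 1]` with the curve given for `s`.
  obtain ⟨γ, J, hJ, hIJ, hG, hinit, -⟩ := h 1 (by simp)
  have h0J : (0 : ℝ) ∈ J := hIJ (by simp)
  obtain ⟨hq, hv⟩ := deriv_comp_chart_of_tangentMap
    ((hat hG hJ h0J).mdifferentiableAt (by decide)) hinit
  refine ⟨γ, J, hJ, hIJ, hG, fun ψ hψ hs => ?_, fun s hs => ?_⟩
  · rw [hv ψ hψ hs, vectorComp_smul, one_smul]
  · obtain ⟨γ', J', hJ', hIJ', hG', hinit', h1⟩ := h s hs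
    obtain ⟨hq', hv'⟩ := deriv_comp_chart_of_tangentMap
      ((hat hG' hJ' (hIJ' (by simp))).mdifferentiableAt (by decide)) hinit'
    have hJs : IsOpen ((fun t => s * t) ⁻¹' J) := hJ.preimage (continuous_const_mul s)
    have hIJs : Set.Icc (0 : ℝ) 1 ⊆ (fun t => s * t) ⁻¹' J := fun t ht =>
      hIJ ⟨mul_nonneg hs.1 ht.1, mul_le_one₀ hs.2 ht.1 ht.2⟩
    have hGs := hscale γ J s hG
    have hq0 : γ (s * 0) = q := by rw [mul_zero, hq]
    have := eqOn_of_local_uniqueness (γ₁ := fun t => γ (s * t)) (γ₂ := γ')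
      (fun t ht => hat hGs hJs (hIJs ht)) (fun t ht => hat hG' hJ' (hIJ' ht))
      (fun t ht => hloc _ _ _ _ t hJs hJ' (hIJs ht) (hIJ' ht) hGs hG')
      (hq0.trans hq'.symm) (fun ψ hψ hs' => by
        rw [hq0] at hs'
        rw [hv' ψ hψ hs', vectorComp_smul]
        refine (deriv_comp_mul_left s (fun t => ψ (γ t)) 0).trans ?_
        rw [mul_zero, hv ψ hψ hs', vectorComp_smul, one_smul]) 1 (by simp)
    rw [← h1, ← this, mul_one]

theorem contMDiffOn_comp_mul {γ : ℝ → M} {J : Set ℝ} (s : ℝ)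
    (h : ContMDiffOn 𝓘(ℝ, ℝ) 𝓘(ℝ, ι → ℝ) ∞ γ J) :
    ContMDiffOn 𝓘(ℝ, ℝ) 𝓘(ℝ, ι → ℝ) ∞ (fun t => γ (s * t)) ((fun t => s * t) ⁻¹' J) :=
  h.comp ((contDiff_const.mul contDiff_id).contMDiff.contMDiffOn (s := (fun t => s * t) ⁻¹' J))
    subset_rfl

theorem eventually_mem_of_contMDiffOn {γ : ℝ → M} {J : Set ℝ} {t : ℝ} {U : Set M}
    (h : ContMDiffOn 𝓘(ℝ, ℝ) 𝓘(ℝ, ι → ℝ) ∞ γ J) (hJ : IsOpen J) (ht : t ∈ J) (hU : IsOpen U)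
    (htU : γ t ∈ U) : ∀ᶠ s in 𝓝 t, s ∈ J ∧ γ s ∈ U :=
  (hJ.eventually_mem ht).and
    ((h.contMDiffAt (hJ.mem_nhds ht)).continuousAt.eventually (hU.mem_nhds htU))

/-- The geodesic with initial velocity `v` passes at time `s` through `exp (s • v)`. -/
theorem exists_geodesic_ray (g : PseudoRiemannianMetric ι M) {q : M}
    {v : TangentSpace 𝓘(ℝ, ι → ℝ) q} {Φ : ℝ → M}
    (h : ∀ s ∈ Set.Icc (0 : ℝ) 1, IsExp g q (s • v) (Φ s)) :
    ∃ (γ : ℝ → M) (J : Set ℝ), IsOpen J ∧ Set.Icc 0 1 ⊆ J ∧ IsGeodesicOn g γ J ∧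
      (∀ ψ ∈ smoothCharts ι M, q ∈ ψ.source →
        deriv (fun s => ψ (γ s)) 0 = vectorComp ψ q v) ∧
      ∀ s ∈ Set.Icc (0 : ℝ) 1, γ s = Φ s := by
  refine exists_ray (IsG := IsGeodesicOn g) (fun _ _ h => h.1) (fun γ J s hG => ?_)
    (fun γ₁ γ₂ J₁ J₂ t hJ₁ hJ₂ ht₁ ht₂ hG₁ hG₂ heq hd => ?_) h
  · exact ⟨contMDiffOn_comp_mul s hG.1, fun ψ hψ t ht hs =>
      covDerivAlong_comp_mul (fun t => ψ (γ t)) s t (hG.2 ψ hψ (s * t) ht hs)⟩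
  · set ψ := chartAt (ι → ℝ) (γ₁ t) with hψ_def
    have hψ : ψ ∈ smoothCharts ι M := IsManifold.chart_mem_maximalAtlas _
    have hs₁ : γ₁ t ∈ ψ.source := mem_chart_source _ _
    have hs₂ : γ₂ t ∈ ψ.source := heq ▸ hs₁
    have e₁ := eventually_mem_of_contMDiffOn hG₁.1 hJ₁ ht₁ ψ.open_source hs₁
    have e₂ := eventually_mem_of_contMDiffOn hG₂.1 hJ₂ ht₂ ψ.open_source hs₂
    have ht : ψ (γ₁ t) ∈ ψ.target := ψ.map_source hs₁
    have := eventuallyEq_of_geodesic (H := g.comp ψ) (c₁ := fun s => ψ (γ₁ s))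
      (c₂ := fun s => ψ (γ₂ s)) (t := t) (g.contDiffAt_comp hψ ht) (g.det_comp_ne_zero hψ ht)
      (contDiffAt_comp_chart hψ (hG₁.1.contMDiffAt (hJ₁.mem_nhds ht₁)) hs₁)
      (contDiffAt_comp_chart hψ (hG₂.1.contMDiffAt (hJ₂.mem_nhds ht₂)) hs₂)
      (e₁.mono fun s hs => hG₁.2 ψ hψ s hs.1 hs.2) (e₂.mono fun s hs => hG₂.2 ψ hψ s hs.1 hs.2)
      (by rw [heq]) (hd ψ hψ hs₁)
    filter_upwards [this, e₁, e₂] with s hs hs₁ hs₂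
    exact ψ.injOn hs₁.2 hs₂.2 hs

end Rays

/-! ### Adapted charts -/

section Adapted

variable {k m : ℕ} {M : Type*} [TopologicalSpace M] [ChartedSpace (Model k m) M]
  [IsManifold 𝓘(ℝ, Model k m) ∞ M] {S : Set M} {ψ : OpenPartialHomeomorph M (Model k m)}

theorem symm_onSlice_mem (hψ : ψ ∈ adaptedCharts S) {x : Fin k → ℝ}
    (hx : onSlice x ∈ ψ.target) : ψ.symm (onSlice x) ∈ S := by
  rw [hψ.2 _ (ψ.map_target hx), ψ.right_inv hx]
  exact fun _ => rfl

theorem onSlice_tangentialPart (hψ : ψ ∈ adaptedCharts S) {q : M} (hq : q ∈ ψ.source)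
    (hS : q ∈ S) : onSlice (tangentialPart (ψ q)) = ψ q := by
  funext i
  rcases i with i | i
  · rfl
  · exact ((hψ.2 q hq).1 hS i).symm

theorem isTangentTo_vectorOf (hψ : ψ ∈ adaptedCharts S) {z : Model k m} (hz : z ∈ ψ.target)
    (v : Fin k → ℝ) : IsTangentTo S (ψ.symm z) (vectorOf ψ z (onSlice v)) :=
  ⟨ψ, hψ, ψ.map_target hz, fun c => by rw [vectorComp_vectorOf hψ.1 hz]; rfl⟩

/-- Tangency to a submanifold may be tested in any adapted chart. -/
theorem vectorComp_inr_of_isTangentTo (hψ : ψ ∈ adaptedCharts S) {q : M} (hq : q ∈ ψ.source)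
    (hS : q ∈ S) {v : TangentSpace 𝓘(ℝ, Model k m) q} (hv : IsTangentTo S q v) (c : Fin m) :
    vectorComp ψ q v (Sum.inr c) = 0 := by
  obtain ⟨ψ', hψ', hq', hv'⟩ := hv
  obtain ⟨z, hz, rfl⟩ : ∃ z ∈ ψ'.target, ψ'.symm z = q :=
    ⟨ψ' q, ψ'.map_source hq', ψ'.left_inv hq'⟩
  set w := vectorComp ψ' (ψ'.symm z) v with hw
  have hF : MDifferentiableAt 𝓘(ℝ, Model k m) 𝓘(ℝ, Model k m) (ψ ∘ ψ'.symm) z :=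
    ((mdifferentiable_of_mem_smoothCharts hψ.1).mdifferentiableAt hq).comp z
      ((mdifferentiable_of_mem_smoothCharts hψ'.1).mdifferentiableAt_symm hz)
  have hchain := mfderiv_comp z ((mdifferentiable_of_mem_smoothCharts hψ.1).mdifferentiableAt hq)
    ((mdifferentiable_of_mem_smoothCharts hψ'.1).mdifferentiableAt_symm hz)
  rw [mfderiv_eq_fderiv] at hchain
  have hvw : vectorComp ψ (ψ'.symm z) v = fderiv ℝ (ψ ∘ ψ'.symm) z w := by
    conv_lhs => rw [← vectorOf_vectorComp hψ'.1 hz v]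
    exact (DFunLike.congr_fun hchain w).symm
  have hline : HasDerivAt (fun t : ℝ => z + t • w) w 0 := by
    simpa using ((hasDerivAt_id (0 : ℝ)).smul_const w).const_add z
  have hz0 : z + (0 : ℝ) • w = z := by simp
  have hF' : HasFDerivAt (ψ ∘ ψ'.symm) (fderiv ℝ (ψ ∘ ψ'.symm) z) (z + (0 : ℝ) • w) := by
    rw [hz0]
    exact hF.differentiableAt.hasFDerivAt
  have hcomp := (hasDerivAt_pi.1 (hF'.comp_hasDerivAt (0 : ℝ) hline)) (Sum.inr c)
  have hzS : ∀ d, z (Sum.inr d) = 0 := fun d => by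
    have := (hψ'.2 _ (ψ'.map_target hz)).1 hS d
    rwa [ψ'.right_inv hz] at this
  -- The line from `z` in direction `w` stays in the slice of `ψ'`, so its image lies in `S` and has
  -- vanishing `u`-components in `ψ`. Differentiation at `0` gives the claim.
  have hzero : (fun t : ℝ => ((ψ ∘ ψ'.symm) ∘ fun t : ℝ => z + t • w) t (Sum.inr c))
      =ᶠ[𝓝 0] fun _ => 0 := by
    have htgt : ∀ᶠ t : ℝ in 𝓝 0, z + t • w ∈ ψ'.target :=
      hline.continuousAt.eventually (ψ'.open_target.mem_nhds (by beta_reduce; rwa [hz0]))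
    have hsrc : ∀ᶠ t : ℝ in 𝓝 0, ψ'.symm (z + t • w) ∈ ψ.source := by
      have hc : ContinuousAt (fun t : ℝ => ψ'.symm (z + t • w)) 0 :=
        ContinuousAt.comp (by rw [hz0]; exact ψ'.continuousAt_symm hz) hline.continuousAt
      exact hc.eventually (ψ.open_source.mem_nhds (by beta_reduce; rwa [hz0]))
    filter_upwards [htgt, hsrc] with t h₁ h₂
    refine (hψ.2 _ h₂).1 ((hψ'.2 _ (ψ'.map_target h₁)).2 fun d => ?_) c
    rw [ψ'.right_inv h₁]
    simp [hzS, hv' d]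
  rw [hvw]
  exact hcomp.unique ((hasDerivAt_const (0 : ℝ) (0 : ℝ)).congr_of_eventuallyEq hzero)

variable {g : PseudoRiemannianMetric (Fin k ⊕ Fin m) M}

theorem contDiffAt_inducedMetric (hψ : ψ ∈ adaptedCharts S) {x : Fin k → ℝ}
    (hx : onSlice x ∈ ψ.target) (a b : Fin k) :
    ContDiffAt ℝ ∞ (fun x => inducedMetric (g.comp ψ) x a b) x :=
  (g.contDiffAt_comp hψ.1 hx (Sum.inl a) (Sum.inl b)).comp x contDiff_onSlice.contDiffAt

/-- A null vector of the matrix would be a nonzero tangent vector orthogonal to the whole tangent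
space, because every tangent vector has only `x`-components in an adapted chart. -/
theorem det_inducedMetric_ne_zero (hS : IsNondegenerate g S) (hψ : ψ ∈ adaptedCharts S)
    {x : Fin k → ℝ} (hx : onSlice x ∈ ψ.target) : (inducedMetric (g.comp ψ) x).det ≠ 0 := by
  intro h
  obtain ⟨v, hv, hv'⟩ := Matrix.exists_vecMul_eq_zero_iff.2 h
  have hmem := symm_onSlice_mem hψ hx
  have h0 : vectorOf ψ (onSlice x) (onSlice v) = 0 := by
    refine hS _ hmem _ (isTangentTo_vectorOf hψ hx v) fun w hw => ?_
    have hw' := vectorComp_inr_of_isTangentTo hψ (ψ.map_target hx) hmem hw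
    rw [g.form_eq hψ.1 hx, vectorComp_vectorOf hψ.1 hx]
    simp only [Fintype.sum_sum_type, hw', zero_mul, Finset.sum_const_zero, add_zero]
    simp only [onSlice, Sum.elim_inl, Sum.elim_inr, Pi.zero_apply, zero_mul,
      Finset.sum_const_zero, add_zero, Finset.mul_sum]
    rw [Finset.sum_comm]
    refine Finset.sum_eq_zero fun b _ => ?_
    have hb : ∑ a, v a * inducedMetric (g.comp ψ) x a b = 0 := congrFun hv' b
    rw [← mul_zero (vectorComp ψ (ψ.symm (onSlice x)) w (Sum.inl b)), ← hb, Finset.mul_sum]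
    exact Finset.sum_congr rfl fun a _ => mul_left_comm _ _ _
  refine hv ?_
  have h1 : vectorComp ψ (ψ.symm (onSlice x)) (vectorOf ψ (onSlice x) (onSlice v)) = 0 := by
    rw [h0]
    exact map_zero (mfderiv 𝓘(ℝ, Model k m) 𝓘(ℝ, Model k m) ψ (ψ.symm (onSlice x)))
  rw [vectorComp_vectorOf hψ.1 hx] at h1
  funext a
  exact congrFun h1 (Sum.inl a)

theorem contDiff_tangentialPart : ContDiff ℝ ∞ (tangentialPart : Model k m → Fin k → ℝ) :=
  contDiff_pi.2 fun a => contDiff_apply ℝ ℝ (Sum.inl a)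

theorem deriv_tangentialPart {c : ℝ → Model k m} {t : ℝ} (hc : DifferentiableAt ℝ c t) :
    deriv (fun s => tangentialPart (c s)) t = tangentialPart (deriv c t) :=
  (hasDerivAt_pi.2 fun a => (hasDerivAt_pi.1 hc.hasDerivAt) (Sum.inl a)).deriv

/-- The geodesic of the pullback metric with initial velocity `v` passes at time `s` through
`exp (s • v)`. -/
theorem exists_inducedGeodesic_ray [T2Space M] (hemb : IsEmbeddedSubmanifold k m S)
    (hS : IsNondegenerate g S) {q : M} {v : TangentSpace 𝓘(ℝ, Model k m) q} {Φ : ℝ → M}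
    (h : ∀ s ∈ Set.Icc (0 : ℝ) 1, IsInducedExp g S q (s • v) (Φ s)) :
    ∃ (γ : ℝ → M) (J : Set ℝ), IsOpen J ∧ Set.Icc 0 1 ⊆ J ∧ IsInducedGeodesicOn g S γ J ∧
      (∀ ψ ∈ smoothCharts (Fin k ⊕ Fin m) M, q ∈ ψ.source →
        deriv (fun s => ψ (γ s)) 0 = vectorComp ψ q v) ∧
      ∀ s ∈ Set.Icc (0 : ℝ) 1, γ s = Φ s := by
  refine exists_ray (IsG := IsInducedGeodesicOn g S) (fun _ _ h => h.1) (fun γ J s hG => ?_)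
    (fun γ₁ γ₂ J₁ J₂ t hJ₁ hJ₂ ht₁ ht₂ hG₁ hG₂ heq hd => ?_) h
  · exact ⟨contMDiffOn_comp_mul s hG.1, fun t ht => hG.2.1 (s * t) ht, fun ψ hψ t ht hs =>
      covDerivAlong_comp_mul (fun t => tangentialPart (ψ (γ t))) s t (hG.2.2 ψ hψ (s * t) ht hs)⟩
  · obtain ⟨ψ, hψ, hs₁⟩ := hemb (γ₁ t) (hG₁.2.1 t ht₁)
    have hs₂ : γ₂ t ∈ ψ.source := heq ▸ hs₁
    have e₁ := eventually_mem_of_contMDiffOn hG₁.1 hJ₁ ht₁ ψ.open_source hs₁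
    have e₂ := eventually_mem_of_contMDiffOn hG₂.1 hJ₂ ht₂ ψ.open_source hs₂
    have ht : onSlice (tangentialPart (ψ (γ₁ t))) ∈ ψ.target := by
      rw [onSlice_tangentialPart hψ hs₁ (hG₁.2.1 t ht₁)]
      exact ψ.map_source hs₁
    have c₁ := contDiffAt_comp_chart hψ.1 (hG₁.1.contMDiffAt (hJ₁.mem_nhds ht₁)) hs₁
    have c₂ := contDiffAt_comp_chart hψ.1 (hG₂.1.contMDiffAt (hJ₂.mem_nhds ht₂)) hs₂
    have := eventuallyEq_of_geodesic (H := inducedMetric (g.comp ψ))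
      (c₁ := fun s => tangentialPart (ψ (γ₁ s))) (c₂ := fun s => tangentialPart (ψ (γ₂ s)))
      (t := t) (contDiffAt_inducedMetric hψ ht) (det_inducedMetric_ne_zero hS hψ ht)
      (contDiff_tangentialPart.contDiffAt.comp t c₁) (contDiff_tangentialPart.contDiffAt.comp t c₂)
      (e₁.mono fun s hs => hG₁.2.2 ψ hψ s hs.1 hs.2) (e₂.mono fun s hs => hG₂.2.2 ψ hψ s hs.1 hs.2)
      (by rw [heq]) (by
        rw [deriv_tangentialPart (c₁.differentiableAt (by decide)),
          deriv_tangentialPart (c₂.differentiableAt (by decide)), hd ψ hψ.1 hs₁])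
    filter_upwards [this, e₁, e₂] with s hs hs₁ hs₂
    refine ψ.injOn hs₁.2 hs₂.2 ?_
    rw [← onSlice_tangentialPart hψ hs₁.2 (hG₁.2.1 s hs₁.1),
      ← onSlice_tangentialPart hψ hs₂.2 (hG₂.2.1 s hs₂.1), hs]

end Adapted

end SubmanifoldNormal

namespace SubmanifoldNormal

/-! ### The metric in a submanifold normal chart -/

section NormalChart

variable {k m : ℕ} {M : Type*} [TopologicalSpace M] [T2Space M] [ChartedSpace (Model k m) M]
  [IsManifold 𝓘(ℝ, Model k m) ∞ M] {g : PseudoRiemannianMetric (Fin k ⊕ Fin m) M} {S : Set M}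
  {p : M} {e : Fin k ⊕ Fin m → TangentSpace 𝓘(ℝ, Model k m) p}
  {φ : OpenPartialHomeomorph M (Model k m)}

theorem smul_mem_ball_zero {E : Type*} [SeminormedAddCommGroup E] [NormedSpace ℝ E] {δ s : ℝ}
    {x : E} (hx : x ∈ Metric.ball 0 δ) (hs : s ∈ Set.Icc (0 : ℝ) 1) : s • x ∈ Metric.ball 0 δ := by
  rw [mem_ball_zero_iff] at hx ⊢
  rw [norm_smul, Real.norm_of_nonneg hs.1]
  exact (mul_le_of_le_one_left (norm_nonneg x) hs.2).trans_lt hx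

theorem two_smul_mem_ball_zero {E : Type*} [SeminormedAddCommGroup E] [NormedSpace ℝ E] {δ : ℝ}
    {x : E} (hx : x ∈ Metric.ball 0 (δ / 2)) : (2 : ℝ) • x ∈ Metric.ball 0 δ := by
  rw [mem_ball_zero_iff] at hx ⊢
  rw [norm_smul, Real.norm_ofNat]
  linarith

theorem vectorComp_sum_smul {κ : Type*} [Fintype κ] (ψ : OpenPartialHomeomorph M (Model k m))
    (q : M) (s : κ → ℝ) (v : κ → TangentSpace 𝓘(ℝ, Model k m) q) :
    vectorComp ψ q (∑ a, s a • v a) = ∑ a, s a • vectorComp ψ q (v a) :=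
  (map_sum (mfderiv 𝓘(ℝ, Model k m) 𝓘(ℝ, Model k m) ψ q) _ _).trans
    (Finset.sum_congr rfl fun a _ => vectorComp_smul ψ q (s a) (v a))

/-- The components of the vectors `v a` are determined by those of their small linear
combinations. -/
theorem vectorComp_eq_of_small {κ : Type} [Fintype κ] [DecidableEq κ]
    (ψ : OpenPartialHomeomorph M (Model k m)) (q : M) (v : κ → TangentSpace 𝓘(ℝ, Model k m) q)
    (w : (κ → ℝ) →ₗ[ℝ] Model k m) {δ : ℝ} (hδ : 0 < δ)
    (h : ∀ x ∈ Metric.ball (0 : κ → ℝ) δ, vectorComp ψ q (∑ a, x a • v a) = w x) (a : κ) :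
    vectorComp ψ q (v a) = w (Pi.single a 1) := by
  have hmem : (δ / 2) • (Pi.single a (1 : ℝ) : κ → ℝ) ∈ Metric.ball (0 : κ → ℝ) δ := by
    rw [mem_ball_zero_iff, norm_smul, Real.norm_of_nonneg (by positivity), Pi.norm_single,
      norm_one]
    linarith
  have := h _ hmem
  rw [vectorComp_sum_smul, map_smul] at this
  refine smul_right_injective (Model k m) (ne_of_gt (half_pos hδ)) ?_
  simpa [Pi.single_apply] using this

theorem sum_elim_mem_ball {δ : ℝ} (hδ : 0 < δ) {x : Fin k → ℝ} {u : Fin m → ℝ}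
    (hx : x ∈ Metric.ball 0 δ) (hu : u ∈ Metric.ball 0 δ) :
    (Sum.elim x u : Model k m) ∈ Metric.ball 0 δ := by
  rw [mem_ball_zero_iff, pi_norm_lt_iff hδ] at hx hu ⊢
  rintro (i | i)
  · exact hx i
  · exact hu i

variable (hemb : IsEmbeddedSubmanifold k m S) (hS : IsNondegenerate g S)
  (hφ : IsSubmanifoldNormalChart g S p e φ)

namespace IsSubmanifoldNormalChart

include hφ in
theorem zero_mem_target : (0 : Model k m) ∈ φ.target :=
  hφ.map_point ▸ φ.map_source hφ.mem_source

include hφ in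
theorem symm_zero : φ.symm 0 = p := by
  rw [← hφ.map_point, φ.left_inv hφ.mem_source]

include hφ in
theorem exists_ball_target : ∃ δ > 0, ∀ z ∈ Metric.ball (0 : Model k m) δ, z ∈ φ.target :=
  Metric.eventually_nhds_iff_ball.1 (φ.open_target.eventually_mem hφ.zero_mem_target)

include hemb hS hφ in
/-- The radial lines in the slice are geodesics of the pullback metric. -/
theorem exists_radial : ∃ δ > 0, ∀ x ∈ Metric.ball (0 : Fin k → ℝ) δ,
    vectorComp φ p (∑ a, x a • e (Sum.inl a)) = onSlice x ∧
    ∀ t ∈ Set.Ioo (0 : ℝ) 1, ∀ l, ∑ a, ∑ b,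
      christoffel (inducedMetric (g.comp φ)) (t • x) l a b * x a * x b = 0 := by
  obtain ⟨δ₁, hδ₁, h₁⟩ := hφ.exists_ball_target
  obtain ⟨δ₂, hδ₂, h₂⟩ := Metric.eventually_nhds_iff_ball.1 hφ.tangential
  refine ⟨min δ₁ δ₂, lt_min hδ₁ hδ₂, fun x hx => ?_⟩
  have hx₁ := Metric.ball_subset_ball (min_le_left δ₁ δ₂) hx
  have hx₂ := Metric.ball_subset_ball (min_le_right δ₁ δ₂) hx
  have htgt : ∀ s ∈ Set.Icc (0 : ℝ) 1, onSlice (s • x) ∈ φ.target := fun s hs =>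
    h₁ _ (sum_elim_mem_ball hδ₁ (smul_mem_ball_zero hx₁ hs) (Metric.mem_ball_self hδ₁))
  have hlin : ∀ s : ℝ, onSlice (m := m) (s • x) = 0 + s • onSlice x := fun s => by
    rw [← onSliceL_apply, map_smul, onSliceL_apply, zero_add]
  obtain ⟨γ, J, hJ, hIJ, hG, hv, hγ⟩ := exists_inducedGeodesic_ray hemb hS
    (v := ∑ a, x a • e (Sum.inl a)) (Φ := fun s => φ.symm (onSlice (s • x))) fun s hs => by
      have hsum : s • ∑ a, x a • e (Sum.inl a) = ∑ a, (s • x) a • e (Sum.inl a) := by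
        rw [Finset.smul_sum]
        exact Finset.sum_congr rfl fun a _ => smul_smul _ _ _
      rw [hsum]
      exact h₂ _ (smul_mem_ball_zero hx₂ hs)
  have hcomp : ∀ s ∈ Set.Icc (0 : ℝ) 1, φ (γ s) = onSlice (s • x) := fun s hs => by
    rw [hγ s hs, φ.right_inv (htgt s hs)]
  have hsrc : ∀ s ∈ Set.Icc (0 : ℝ) 1, γ s ∈ φ.source := fun s hs => by
    rw [hγ s hs]
    exact φ.map_target (htgt s hs)
  have h0 : (0 : ℝ) ∈ Set.Icc (0 : ℝ) 1 := by simp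
  constructor
  · rw [← hv φ hφ.adapted.1 hφ.mem_source]
    refine deriv_eq_of_affine (z := 0) ?_ fun s hs => (hcomp s hs).trans (hlin s)
    exact (contDiffAt_comp_chart hφ.adapted.1 (hG.1.contMDiffAt (hJ.mem_nhds (hIJ h0)))
      (hsrc 0 h0)).differentiableAt (by decide)
  · intro t ht l
    have ht' := Set.Ioo_subset_Icc_self ht
    -- Second derivatives need a neighbourhood of `t`, and the ray is known to be straight only on
    -- `[0, 1]`. Hence the open interval.
    have haff : (fun s => tangentialPart (φ (γ s))) =ᶠ[𝓝 t] fun s => 0 + s • x := by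
      filter_upwards [Icc_mem_nhds ht.1 ht.2] with s hs
      rw [hcomp s hs, zero_add]
      rfl
    have := sum_christoffel_of_affine haff (hG.2.2 φ hφ.adapted t (hIJ ht') (hsrc t ht')) l
    rwa [zero_add] at this

include hφ in
/-- The lines in the normal directions are geodesics. -/
theorem exists_normal {E : Fin m → ∀ q : M, TangentSpace 𝓘(ℝ, Model k m) q}
    (hE : ∀ᶠ z : Model k m in 𝓝 0,
      IsExp g (φ.symm (onSlice (tangentialPart z)))
        (∑ c, z (Sum.inr c) • E c (φ.symm (onSlice (tangentialPart z)))) (φ.symm z)) :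
    ∃ δ > 0, ∀ x ∈ Metric.ball (0 : Fin k → ℝ) δ, onSlice x ∈ φ.target ∧
      ∀ u ∈ Metric.ball (0 : Fin m → ℝ) δ,
        vectorComp φ (φ.symm (onSlice x)) (∑ c, u c • E c (φ.symm (onSlice x)))
          = Sum.elim (0 : Fin k → ℝ) u ∧
        ∀ t ∈ Set.Ioo (0 : ℝ) 1, ∀ i, ∑ a, ∑ b, christoffel (g.comp φ) (Sum.elim x (t • u)) i
          (Sum.inr a) (Sum.inr b) * u a * u b = 0 := by
  obtain ⟨δ₁, hδ₁, h₁⟩ := hφ.exists_ball_target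
  obtain ⟨δ₂, hδ₂, h₂⟩ := Metric.eventually_nhds_iff_ball.1 hE
  refine ⟨min δ₁ δ₂, lt_min hδ₁ hδ₂, fun x hx => ?_⟩
  have hx₁ := Metric.ball_subset_ball (min_le_left δ₁ δ₂) hx
  have hx₂ := Metric.ball_subset_ball (min_le_right δ₁ δ₂) hx
  have hx0 : onSlice x ∈ φ.target :=
    h₁ _ (sum_elim_mem_ball hδ₁ hx₁ (Metric.mem_ball_self hδ₁))
  refine ⟨hx0, fun u hu => ?_⟩
  have hu₁ := Metric.ball_subset_ball (min_le_left δ₁ δ₂) hu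
  have hu₂ := Metric.ball_subset_ball (min_le_right δ₁ δ₂) hu
  have htgt : ∀ s ∈ Set.Icc (0 : ℝ) 1, (Sum.elim x (s • u) : Model k m) ∈ φ.target := fun s hs =>
    h₁ _ (sum_elim_mem_ball hδ₁ hx₁ (smul_mem_ball_zero hu₁ hs))
  have hlin : ∀ s : ℝ, (Sum.elim x (s • u) : Model k m)
      = onSlice x + s • (Sum.elim (0 : Fin k → ℝ) u : Model k m) := fun s => by
    funext i
    rcases i with i | i <;> simp [onSlice]
  obtain ⟨γ, J, hJ, hIJ, hG, hv, hγ⟩ := exists_geodesic_ray g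
    (v := ∑ c, u c • E c (φ.symm (onSlice x))) (Φ := fun s => φ.symm (Sum.elim x (s • u)))
    fun s hs => by
      have hsum : s • ∑ c, u c • E c (φ.symm (onSlice x))
          = ∑ c, (s • u) c • E c (φ.symm (onSlice x)) := by
        rw [Finset.smul_sum]
        exact Finset.sum_congr rfl fun c _ => smul_smul _ _ _
      rw [hsum]
      exact h₂ _ (sum_elim_mem_ball hδ₂ hx₂ (smul_mem_ball_zero hu₂ hs))
  have hcomp : ∀ s ∈ Set.Icc (0 : ℝ) 1, φ (γ s)
      = onSlice x + s • (Sum.elim (0 : Fin k → ℝ) u : Model k m) := fun s hs => by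
    rw [hγ s hs, φ.right_inv (htgt s hs), hlin]
  have hsrc : ∀ s ∈ Set.Icc (0 : ℝ) 1, γ s ∈ φ.source := fun s hs => by
    rw [hγ s hs]
    exact φ.map_target (htgt s hs)
  have h0 : (0 : ℝ) ∈ Set.Icc (0 : ℝ) 1 := by simp
  constructor
  · rw [← hv φ hφ.adapted.1 (φ.map_target hx0)]
    refine deriv_eq_of_affine ?_ hcomp
    exact (contDiffAt_comp_chart hφ.adapted.1 (hG.1.contMDiffAt (hJ.mem_nhds (hIJ h0)))
      (hsrc 0 h0)).differentiableAt (by decide)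
  · intro t ht i
    have ht' := Set.Ioo_subset_Icc_self ht
    have haff : (fun s => φ (γ s)) =ᶠ[𝓝 t]
        fun s => onSlice x + s • (Sum.elim (0 : Fin k → ℝ) u : Model k m) := by
      filter_upwards [Icc_mem_nhds ht.1 ht.2] with s hs
      exact hcomp s hs
    have := sum_christoffel_of_affine haff (hG.2 φ hφ.adapted.1 t (hIJ ht') (hsrc t ht')) i
    rw [← hlin] at this
    simpa [Fintype.sum_sum_type] using this

theorem form_eq_of_single {z : Model k m} (hφ : φ ∈ smoothCharts (Fin k ⊕ Fin m) M)
    (hz : z ∈ φ.target) {v w : TangentSpace 𝓘(ℝ, Model k m) (φ.symm z)} {i j : Fin k ⊕ Fin m}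
    (hv : vectorComp φ (φ.symm z) v = Pi.single i 1)
    (hw : vectorComp φ (φ.symm z) w = Pi.single j 1) :
    g.form (φ.symm z) v w = g.comp φ z i j := by
  rw [g.form_eq hφ hz, hv, hw]
  simp [Pi.single_apply]

include hφ in
theorem form_eq_comp_zero {v w : TangentSpace 𝓘(ℝ, Model k m) p} {i j : Fin k ⊕ Fin m}
    (hv : vectorComp φ p v = Pi.single i 1) (hw : vectorComp φ p w = Pi.single j 1) :
    g.form p v w = g.comp φ 0 i j := by
  -- The tangent space depends on the base point. A free point `q` allows `φ.symm 0 = p` to be used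
  -- by substitution.
  have h : ∀ q, q = p → ∀ v w : Model k m, vectorComp φ p v = Pi.single i 1 →
      vectorComp φ p w = Pi.single j 1 → φ.symm 0 = q → g.form q v w = g.comp φ 0 i j := by
    rintro q hq v w hv hw rfl
    rw [← hq] at hv hw
    exact form_eq_of_single hφ.adapted.1 hφ.zero_mem_target hv hw
  exact h p rfl v w hv hw hφ.symm_zero

include hemb hS hφ in
/-- The metric in a submanifold normal chart satisfies the gauge conditions. -/
theorem isNormalMetric {h₁ : Matrix (Fin k) (Fin k) ℝ} {h₂ : Matrix (Fin m) (Fin m) ℝ}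
    (he : IsAdaptedFrame g S p h₁ h₂ e) : IsNormalMetric h₁ h₂ (g.comp φ) := by
  obtain ⟨δ, hδ, hrad⟩ := hφ.exists_radial hemb hS
  obtain ⟨E, hEp, hpar, hexp⟩ := hφ.normal
  obtain ⟨ε, hε, hnor⟩ := hφ.exists_normal hexp
  have hframe : ∀ a, vectorComp φ p (e (Sum.inl a)) = Pi.single (Sum.inl a) 1 := fun a => by
    rw [vectorComp_eq_of_small φ p (fun a => e (Sum.inl a)) (onSliceL k m).toLinearMap hδ
      (fun x hx => (hrad x hx).1.trans (onSliceL_apply x).symm) a]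
    exact (onSliceL_apply _).trans (onSlice_single a)
  have hE : ∀ x ∈ Metric.ball (0 : Fin k → ℝ) ε, ∀ c,
      vectorComp φ (φ.symm (onSlice x)) (E c (φ.symm (onSlice x))) = Pi.single (Sum.inr c) 1 := by
    intro x hx c
    let w : (Fin m → ℝ) →ₗ[ℝ] Model k m :=
      { toFun := fun u => Sum.elim (0 : Fin k → ℝ) u
        map_add' := fun u v => by funext i; rcases i with i | i <;> simp
        map_smul' := fun s u => by funext i; rcases i with i | i <;> simp }
    rw [vectorComp_eq_of_small φ _ (fun c => E c (φ.symm (onSlice x))) w hε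
      (fun u hu => ((hnor x hx).2 u hu).1) c]
    funext i
    rcases i with i | i <;> simp [w, Pi.single_apply]
  have hEzero : ∀ c, vectorComp φ p (e (Sum.inr c)) = Pi.single (Sum.inr c) 1 := fun c => by
    have h := hE 0 (Metric.mem_ball_self hε) c
    have hq : φ.symm (onSlice 0) = p := by rw [onSlice_zero, hφ.symm_zero]
    rw [hq, hEp c] at h
    exact h
  -- The sections `E c` are normal to `S` and are the coordinate vectors `∂_{c}` by `hE`, whereas
  -- the `∂_a` are tangent.
  have horth : ∀ᶠ x : Fin k → ℝ in 𝓝 0, ∀ a c,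
      g.comp φ (onSlice x) (Sum.inl a) (Sum.inr c) = 0 := by
    filter_upwards [hpar, Metric.ball_mem_nhds 0 hε] with x hx hxε a c
    have hx1 : (1 : ℝ) • x ∈ Metric.ball (0 : Fin k → ℝ) ε := by rwa [one_smul]
    have ht := (hnor _ hx1).1
    have h := form_eq_of_single (g := g) hφ.adapted.1 ht
      ((vectorComp_vectorOf hφ.adapted.1 ht _).trans (onSlice_single a)) (hE _ hx1 c)
    rw [(hx c 1 (by simp)).2.1 _ (isTangentTo_vectorOf hφ.adapted ht _), one_smul] at h
    exact h.symm
  have hsymm : ∀ z i j, g.comp φ z i j = g.comp φ z j i := fun z i j => g.symm _ _ _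
  refine ⟨g.contDiffAt_comp hφ.adapted.1 hφ.zero_mem_target,
    Filter.Eventually.of_forall hsymm, ?_, horth, ?_, ?_, ?_⟩
  · have h0 := horth.self_of_nhds
    rw [onSlice_zero] at h0
    ext i j
    rcases i with i | i <;> rcases j with j | j
    · exact (hφ.form_eq_comp_zero (hframe i) (hframe j)).symm.trans (he.form_tangent i j)
    · exact h0 i j
    · exact (hsymm _ _ _).trans (h0 j i)
    · exact (hφ.form_eq_comp_zero (hEzero i) (hEzero j)).symm.trans (he.form_normal i j)
  · filter_upwards [Metric.ball_mem_nhds 0 (half_pos hδ)] with x hx l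
    -- The geodesic equation is available at times strictly between `0` and `1`. The point `x` is
    -- reached at time `1/2` along the ray of `2x`, which explains the halved radius and the factor
    -- `4`.
    have h := (hrad _ (two_smul_mem_ball_zero hx)).2 (1 / 2) (by norm_num) l
    rw [smul_smul, show (1 / 2 : ℝ) * 2 = 1 by norm_num, one_smul] at h
    have h4 : (4 : ℝ) * ∑ a, x a * ∑ b, x b * christoffel (inducedMetric (g.comp φ)) x l a b
        = 0 := by
      rw [← h]
      simp only [Finset.mul_sum, Pi.smul_apply, smul_eq_mul]
      exact Finset.sum_congr rfl fun a _ => Finset.sum_congr rfl fun b _ => by ring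
    linarith
  · filter_upwards [hpar, Metric.ball_mem_nhds 0 (half_pos hε)] with x hx hxε b c
    -- The parallel equation is read off at time `1`. Near that time the section has constant
    -- components and the curve has velocity `x`, so only the Christoffel term survives.
    have hnear : ∀ᶠ s : ℝ in 𝓝 1, s • x ∈ Metric.ball (0 : Fin k → ℝ) ε := by
      have hc : ContinuousAt (fun s : ℝ => s • x) 1 := by fun_prop
      refine hc.eventually (Metric.isOpen_ball.mem_nhds ?_)
      beta_reduce
      rw [one_smul]
      exact Metric.ball_subset_ball (by linarith) hxε
    have hφγ : (fun s : ℝ => φ (φ.symm (onSlice (s • x)))) =ᶠ[𝓝 1] fun s => s • onSlice x := by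
      filter_upwards [hnear] with s hs
      rw [φ.right_inv (hnor _ hs).1, ← onSliceL_apply, map_smul, onSliceL_apply]
    have hcomp : (fun s : ℝ => vectorComp φ (φ.symm (onSlice (s • x)))
        (E b (φ.symm (onSlice (s • x))))) =ᶠ[𝓝 1] fun _ => Pi.single (Sum.inr b) 1 := by
      filter_upwards [hnear] with s hs
      exact hE _ hs b
    have hsrc : φ.symm (onSlice ((1 : ℝ) • x)) ∈ φ.source :=
      φ.map_target (hnor _ hnear.self_of_nhds).1
    have h := congrFun ((hx b 1 (by simp)).2.2 φ hφ.adapted hsrc).2 (Sum.inr c)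
    have hd₁ : ∀ j, deriv (fun s : ℝ => φ (φ.symm (onSlice (s • x))) j) 1 = onSlice x j := by
      intro j
      have : (fun s : ℝ => φ (φ.symm (onSlice (s • x))) j) =ᶠ[𝓝 1] fun s => s * onSlice x j :=
        hφγ.mono fun s hs => congrFun hs j
      rw [this.deriv_eq]
      simp
    have hd₂ : ∀ j, deriv (fun s : ℝ => vectorComp φ (φ.symm (onSlice (s • x)))
        (E b (φ.symm (onSlice (s • x)))) j) 1 = 0 := by
      intro j
      have : (fun s : ℝ => vectorComp φ (φ.symm (onSlice (s • x)))
          (E b (φ.symm (onSlice (s • x)))) j) =ᶠ[𝓝 1]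
          fun _ => (Pi.single (Sum.inr b) 1 : Model k m) j :=
        hcomp.mono fun s hs => congrFun hs j
      rw [this.deriv_eq, deriv_const]
    have h1 := φ.right_inv (hnor x (Metric.ball_subset_ball (by linarith) hxε)).1
    have h2 := hcomp.self_of_nhds
    simp only [normalProj, Sum.elim_inr, covDerivAlong, hd₁, hd₂, h1, h2, one_smul, zero_add,
      Pi.zero_apply] at h
    rw [← h, Fintype.sum_sum_type]
    simp [onSlice, Pi.single_apply, mul_comm]
  · filter_upwards [Metric.ball_mem_nhds (0 : Model k m) (half_pos hε)] with z hz i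
    rw [mem_ball_zero_iff, pi_norm_lt_iff (half_pos hε)] at hz
    have hx : (fun a => z (Sum.inl a)) ∈ Metric.ball (0 : Fin k → ℝ) ε := by
      rw [mem_ball_zero_iff, pi_norm_lt_iff hε]
      exact fun a => (hz _).trans (by linarith)
    have hu : (fun c => z (Sum.inr c)) ∈ Metric.ball (0 : Fin m → ℝ) (ε / 2) := by
      rw [mem_ball_zero_iff, pi_norm_lt_iff (half_pos hε)]
      exact fun c => hz _
    -- The same doubling, now in `u` alone with `x` fixed.
    have h := ((hnor _ hx).2 _ (two_smul_mem_ball_zero hu)).2 (1 / 2) (by norm_num) i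
    have hz' : (Sum.elim (fun a => z (Sum.inl a)) fun c => z (Sum.inr c) : Model k m) = z := by
      funext i
      rcases i with i | i <;> rfl
    rw [smul_smul, show (1 / 2 : ℝ) * 2 = 1 by norm_num, one_smul, hz'] at h
    have h4 : (4 : ℝ) * ∑ a, z (Sum.inr a) * ∑ b, z (Sum.inr b) *
        christoffel (g.comp φ) z i (Sum.inr a) (Sum.inr b) = 0 := by
      rw [← h]
      simp only [Finset.mul_sum, Pi.smul_apply, smul_eq_mul]
      exact Finset.sum_congr rfl fun a _ => Finset.sum_congr rfl fun b _ => by ring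
    linarith

end IsSubmanifoldNormalChart

end NormalChart

end SubmanifoldNormal
theorem theorem1p1 {k m : ℕ} (hk : 1 ≤ k) (hm : 1 ≤ m)
    (h₁ : Matrix (Fin k) (Fin k) ℝ) (h₁_symm : h₁.IsSymm) (h₁_nondeg : h₁.det ≠ 0)
    (h₂ : Matrix (Fin m) (Fin m) ℝ) (h₂_symm : h₂.IsSymm) (h₂_nondeg : h₂.det ≠ 0)
    (i j : Fin k ⊕ Fin m) (K : List (Fin k ⊕ Fin m)) :
    ∃ P : MvPolynomial (SubmanifoldNormal.CurvatureVar k m) ℝ,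
      ∀ (M : Type*) [TopologicalSpace M] [T2Space M]
        [ChartedSpace (SubmanifoldNormal.Model k m) M]
        [IsManifold 𝓘(ℝ, SubmanifoldNormal.Model k m) ∞ M]
        (g : SubmanifoldNormal.PseudoRiemannianMetric (Fin k ⊕ Fin m) M)
        (S : Set M) (_ : SubmanifoldNormal.IsEmbeddedSubmanifold k m S)
        (_ : SubmanifoldNormal.IsNondegenerate g S)
        (p : M) (_ : p ∈ S)
        (e : Fin k ⊕ Fin m → TangentSpace 𝓘(ℝ, SubmanifoldNormal.Model k m) p)
        (_ : SubmanifoldNormal.IsAdaptedFrame g S p h₁ h₂ e)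
        (φ : OpenPartialHomeomorph M (SubmanifoldNormal.Model k m))
        (_ : SubmanifoldNormal.IsSubmanifoldNormalChart g S p e φ),
        SubmanifoldNormal.iterPartial K (fun z => g.comp φ z i j) 0 =
          MvPolynomial.eval (SubmanifoldNormal.curvatureValue (g.comp φ)) P := by
  obtain ⟨P, hP⟩ :=
    SubmanifoldNormal.exists_polynomial_iterPartial h₁_nondeg h₂_nondeg i j K
  exact ⟨P, fun M _ _ _ _ g S hemb hS p _ e he φ hφ => hP _ (hφ.isNormalMetric hemb hS he)⟩
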